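/- Let $n$ be a positive integer and $[n]=\{1,\dots,n\}$. For $w:2^{[n]}\to\mathbb R$ put $$Q_w=\Bigl\{x\in\mathbb R^n:\ \sum_{i=1}^n x_i=w([n]),\ \ \sum_{i\in I}x_i\le w(I)\ \text{ for all } \emptyset\ne I\subseteq[n]\Bigr\}.$$ The function $w$ is submodular if $w(I)+w(J)\ge w(I\cap J)+w(I\cup J)$ for all $I,J\subseteq[n]$, and $\mathbf C_n\subset\mathbb R^{2^n}$ is the cone of all submodular functions. A vector $u\in\mathbb R^n$ with distinct coordinates has descent vector $\delta\in S_n$ if $u_{\delta_1}>u_{\delta_2}>\dots>u_{\delta_n}$; the chamber of $\delta$ is $\{u: u_{\delta_1}\ge\dots\ge u_{\delta_n}\}$. Consider the following four classes of objects. 1. Submodular rank tests: partitions $\tau$ of $S_n$ for which there is a submodular $w$ with $w(\emptyset)=0$ such that, for all $u,v\in\mathbb R^n$ with distinct coordinates and descent vectors $\delta,\varepsilon$, the permutations $\delta,\varepsilon$ are in the same class of $\tau$ if and only if maximizing $u\cdot x$ and $v\cdot x$ over $x\in Q_w$ gives the same optimal solutions. Such a $\tau$ is called the rank test of $w$. 2.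 Summands of the permutohedron $\mathbf P_n=\operatorname{conv}\{(\rho_1,\dots,\rho_n): \{\rho_1,\dots,\rho_n\}=[n]\}$, that is, nonempty convex polytopes $Q\subset\mathbb R^n$ whose normal fan (with outer normals) is refined by the normal fan of $\mathbf P_n$; two of them are identified if they have the same normal fan. 3. Structural conditional independence models on $[n]$. For pairwise disjoint $A,B,C\subseteq[n]$ let $u_{\langle A,B|C\rangle}=\delta_{A\cup B\cup C}+\delta_C-\delta_{A\cup C}-\delta_{B\cup C}\in\mathbb Z^{2^{[n]}}$, where $\delta_I$ is the unit vector of $I$; it is elementary if $A,B$ are singletons. A vector $u\in\mathbb Z^{2^{[n]}}$ is a structural imset if some positive integer multiple of $u$ is a sum of elementary vectors, repetitions and the empty sum being allowed. A structural model is a set of the form $\{(A,B,C)\text{ pairwise disjoint}: k\,u-u_{\langle A,B|C\rangle}\text{ is a structural imset for some integer }k\ge1\}$ with $u$ a structural imset. 4. Nonempty faces of $\mathbf C_n$. These classes are in bijection. More precisely, there are bijections $\tau\mapsto[Q_\tau]$, $\tau\mapsto M_\tau$, $\tau\mapsto F_\tau$ from class 1 onto classes 2, 3 and 4, respectively, such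 that: (a) for every submodular rank test $\tau$ and every summand $Q$ of $\mathbf P_n$, $[Q_\tau]=[Q]$ if and only if $\tau$ is the partition of $S_n$ induced by the normal fan of $Q$, i.e. $\delta,\varepsilon$ are in the same class of $\tau$ exactly when their chambers lie in a common cone of that fan; (b) for every $\tau$, every $\delta\in S_n$ and $1\le k<n$, the statement $\delta_k\perp\!\!\!\perp\delta_{k+1}\mid\{\delta_1,\dots,\delta_{k-1}\}$ belongs to $M_\tau$ if and only if $\delta$ and the permutation obtained from it by exchanging $\delta_k$ and $\delta_{k+1}$ are in the same class of $\tau$; (c) every submodular $w$ with $w(\emptyset)=0$ has a rank test $\tau$, and for it $Q_w$ is a summand of $\mathbf P_n$ with $[Q_\tau]=[Q_w]$, $M_\tau$ is the set of all pairwise disjoint $(A,B,C)$ with $w(A\cup C)+w(B\cup C)=w(A\cup B\cup C)+w(C)$, and $F_\tau$ is the smallest face of $\mathbf C_n$ that contains $w$. -/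

import Mathlib

namespace RankTest

/-! ### Faces and normal fans, in coordinates -/

/-- The optimal solutions of: maximize `u · x` subject to `x ∈ P`. -/
def maximizers {ι : Type} [Fintype ι] (P : Set (ι → ℝ)) (u : ι → ℝ) : Set (ι → ℝ) :=
  {x | x ∈ P ∧ ∀ y ∈ P, u ⬝ᵥ y ≤ u ⬝ᵥ x}

/-- `F` is a nonempty face of the polyhedron `P`: the set of points of `P` at which
some linear functional attains its maximum over `P`. -/
def IsFace {ι : Type} [Fintype ι] (P F : Set (ι → ℝ)) : Prop :=
  F.Nonempty ∧ ∃ c : ι → ℝ, F = maximizers P c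

/-- The (outer) normal cone of `P` at `F`: the functionals maximized over `P` on all of `F`. -/
def normalCone {ι : Type} [Fintype ι] (P F : Set (ι → ℝ)) : Set (ι → ℝ) :=
  {u | F ⊆ maximizers P u}

/-- The normal fan of `P`: the normal cones at the nonempty faces of `P`. -/
def normalFan {ι : Type} [Fintype ι] (P : Set (ι → ℝ)) : Set (Set (ι → ℝ)) :=
  {C | ∃ F, IsFace P F ∧ C = normalCone P F}

/-- A (nonempty) convex polytope: the convex hull of finitely many points. -/
def IsPolytope {ι : Type} (P : Set (ι → ℝ)) : Prop :=
  ∃ S : Set (ι → ℝ), S.Finite ∧ S.Nonempty ∧ P = convexHull ℝ S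

/-- The fan `G` refines the fan `H`: each cone of `G` lies in a cone of `H`. -/
def Refines {ι : Type} (G H : Set (Set (ι → ℝ))) : Prop :=
  ∀ C ∈ G, ∃ D ∈ H, C ⊆ D

/-! ### Summands of the permutohedron -/

/-- The permutohedron: the convex hull of all rank vectors, which are the vectors with
coordinates `1, …, n` in some order. -/
def permutohedron (n : ℕ) : Set (Fin n → ℝ) :=
  convexHull ℝ (Set.range fun (ρ : Equiv.Perm (Fin n)) (i : Fin n) => (((ρ i : ℕ) : ℝ) + 1))

/-- `Q` is a polytope whose normal fan is refined by that of the permutohedron. -/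
def IsSummand (n : ℕ) (Q : Set (Fin n → ℝ)) : Prop :=
  IsPolytope Q ∧ Refines (normalFan (permutohedron n)) (normalFan Q)

abbrev Summand (n : ℕ) : Type := {Q : Set (Fin n → ℝ) // IsSummand n Q}

/-- Two summands are normally equivalent when they have the same normal fan. -/
def normalEquivalence (n : ℕ) : Setoid (Summand n) :=
  Setoid.ker fun Q => normalFan Q.1

/-- Summands of the permutohedron up to normal equivalence. -/
abbrev SummandClass (n : ℕ) : Type := Quotient (normalEquivalence n)

def Summand.toClass {n : ℕ} (Q : Summand n) : SummandClass n :=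
  Quotient.mk (normalEquivalence n) Q

/-! ### Submodular functions and submodular rank tests -/

def IsSubmodular {n : ℕ} (w : Finset (Fin n) → ℝ) : Prop :=
  ∀ I J : Finset (Fin n), w (I ∩ J) + w (I ∪ J) ≤ w I + w J

/-- The polytope `Q_w`. -/
def basePolytope {n : ℕ} (w : Finset (Fin n) → ℝ) : Set (Fin n → ℝ) :=
  {x | ∑ i, x i = w Finset.univ ∧ ∀ I : Finset (Fin n), I.Nonempty → ∑ i ∈ I, x i ≤ w I}

/-- The permutation `δ` is the descent vector of `u`: `u (δ 0) > u (δ 1) > ⋯`. -/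
def IsDescentVector {n : ℕ} (u : Fin n → ℝ) (δ : Equiv.Perm (Fin n)) : Prop :=
  StrictAnti fun k => u (δ k)

/-- The maximal cone of the `S_n`-fan indexed by the descent vector `δ`. -/
def chamber {n : ℕ} (δ : Equiv.Perm (Fin n)) : Set (Fin n → ℝ) :=
  {u | Antitone fun k => u (δ k)}

/-- The partition `τ` of the symmetric group is the rank test given by solving the linear
program "maximize `u · x` over `Q_w`" for data vectors `u` with distinct coordinates:
two permutations are in the same class exactly when data vectors realizing them have the
same optimal solution. As `τ` is reflexive, this includes that the
optimal solution depends on the data vector through its permutation only. -/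
def IsTestOf {n : ℕ} (τ : Setoid (Equiv.Perm (Fin n))) (w : Finset (Fin n) → ℝ) : Prop :=
  ∀ (u v : Fin n → ℝ) (δ ε : Equiv.Perm (Fin n)), IsDescentVector u δ → IsDescentVector v ε →
    (τ δ ε ↔ maximizers (basePolytope w) u = maximizers (basePolytope w) v)

/-- A submodular rank test: a partition of the symmetric group that is the
rank test of a submodular function `w` with `w ∅ = 0`. -/
def IsSubmodularRankTest {n : ℕ} (τ : Setoid (Equiv.Perm (Fin n))) : Prop :=
  ∃ w : Finset (Fin n) → ℝ, w ∅ = 0 ∧ IsSubmodular w ∧ IsTestOf τ w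

abbrev SubmodularRankTest (n : ℕ) : Type :=
  {τ : Setoid (Equiv.Perm (Fin n)) // IsSubmodularRankTest τ}

/-- The partition `τ` is induced by the fan `G`: two permutations are in
the same class exactly when their chambers lie in a common cone of `G`. -/
def IsInducedBy {n : ℕ} (τ : Setoid (Equiv.Perm (Fin n))) (G : Set (Set (Fin n → ℝ))) : Prop :=
  ∀ δ ε : Equiv.Perm (Fin n), τ δ ε ↔ ∃ D ∈ G, chamber δ ⊆ D ∧ chamber ε ⊆ D

/-! ### The submodular cone -/

def submodularCone (n : ℕ) : Set (Finset (Fin n) → ℝ) := {w | IsSubmodular w}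

/-- Nonempty faces of the submodular cone, ordered by inclusion. -/
abbrev SubmodularFace (n : ℕ) : Type :=
  {F : Set (Finset (Fin n) → ℝ) // IsFace (submodularCone n) F}

/-! ### Structural conditional independence models -/

/-- The triple `(A, B, C)` stands for the statement `A ⊥ B | C`. -/
abbrev Triple (n : ℕ) : Type := Finset (Fin n) × Finset (Fin n) × Finset (Fin n)

def IsDisjointTriple {n : ℕ} (t : Triple n) : Prop :=
  Disjoint t.1 t.2.1 ∧ Disjoint t.1 t.2.2 ∧ Disjoint t.2.1 t.2.2

/-- The semi-elementary imset `δ_{A ∪ B ∪ C} + δ_C - δ_{A ∪ C} - δ_{B ∪ C}`. -/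
def imset {n : ℕ} (t : Triple n) : Finset (Fin n) → ℤ :=
  Pi.single (t.1 ∪ t.2.1 ∪ t.2.2) 1 + Pi.single t.2.2 1
    - Pi.single (t.1 ∪ t.2.2) 1 - Pi.single (t.2.1 ∪ t.2.2) 1

/-- Elementary imsets: those of the statements `i ⊥ j | K` with `i ≠ j` outside `K`. -/
def elementaryImsets (n : ℕ) : Set (Finset (Fin n) → ℤ) :=
  {u | ∃ (i j : Fin n) (K : Finset (Fin n)), i ≠ j ∧ i ∉ K ∧ j ∉ K ∧ u = imset ({i}, {j}, K)}

/-- A structural imset: some positive integer multiple is a combination of elementary imsets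
with nonnegative integer coefficients. -/
def IsStructuralImset {n : ℕ} (u : Finset (Fin n) → ℤ) : Prop :=
  ∃ k : ℕ, 0 < k ∧ k • u ∈ AddSubmonoid.closure (elementaryImsets n)

/-- The conditional independence model represented by the imset `u`. -/
def imsetModel {n : ℕ} (u : Finset (Fin n) → ℤ) : Set (Triple n) :=
  {t | IsDisjointTriple t ∧ ∃ k : ℕ, 0 < k ∧ IsStructuralImset (k • u - imset t)}

/-- A structural model: one represented by a structural imset. -/
def IsStructuralModel {n : ℕ} (M : Set (Triple n)) : Prop :=
  ∃ u : Finset (Fin n) → ℤ, IsStructuralImset u ∧ M = imsetModel u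

abbrev StructuralModel (n : ℕ) : Type := {M : Set (Triple n) // IsStructuralModel M}

/-- The conditional independence statements satisfied by a function on subsets. -/
def functionModel {n : ℕ} (w : Finset (Fin n) → ℝ) : Set (Triple n) :=
  {t | IsDisjointTriple t ∧
    w (t.1 ∪ t.2.2) + w (t.2.1 ∪ t.2.2) = w (t.1 ∪ t.2.1 ∪ t.2.2) + w t.2.2}

/-- The label `δ_k ⊥ δ_l | {δ_1, …, δ_{k-1}}` of the wall between the chambers of `δ` and of
`δ * Equiv.swap k l`, where `l` is the successor of `k`. -/
def wallLabel {n : ℕ} (δ : Equiv.Perm (Fin n)) (k l : Fin n) : Triple n :=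
  ({δ k}, {δ l}, (Finset.Iio k).image δ)

end RankTest

open RankTest

namespace RankTest

/-! All four classes are quotients of one set, the submodular functions with `w ∅ = 0`, by one
relation: mutual domination, where `Dominates w v` means that `w - c • v` is submodular for some `c
> 0`. Each class is the target of a surjection from this set, and surjections with equal kernels
have equivalent targets (`exists_equiv_of_ker_eq`); the remaining clauses are checked on a
representative `w`.

The kernels agree because each object records which elementary inequalities are tight at `w`. There
are finitely many of these and they imply submodularity (`isSubmodular_of_elementary`), so `w`
dominates `v` once `v` is tight wherever `w` is (`dominates_of_elementary`). An elementary
inequality labels a wall between adjacent chambers and is tight exactly when the greedy vertices on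
both sides coincide (`wallLabel_mem_functionModel_iff`); as `Q_w` is the convex hull of its greedy
vertices, this links `w` to its rank test and normal fan. Conversely, greedy vertices are linear in
`w`, so domination carries optimality from `Q_w` to `Q_v` (`Dominates.greedy_mem_maximizers`).

For surjectivity, a summand is `Q_w` with `w` its support function at indicator vectors. A face is
the minimal face of a point in its relative interior. For a model, Farkas' lemma over `ℚ` separates
each missing elementary statement by a submodular function, and the sum of these functions
represents the model. -/

/-- The set of the first `k` entries of `δ`. -/
def prefixSet {n : ℕ} (δ : Equiv.Perm (Fin n)) (k : ℕ) : Finset (Fin n) :=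
  Finset.univ.filter fun i => (δ.symm i : ℕ) < k

/-- The vertex of `Q_w` found by the greedy algorithm along `δ`. -/
def greedy {n : ℕ} (w : Finset (Fin n) → ℝ) (δ : Equiv.Perm (Fin n)) (i : Fin n) : ℝ :=
  w (prefixSet δ (δ.symm i + 1)) - w (prefixSet δ (δ.symm i))

variable {n : ℕ}

/-! ### Prefixes and the greedy algorithm -/

theorem mem_prefixSet {δ : Equiv.Perm (Fin n)} {k : ℕ} {i : Fin n} :
    i ∈ prefixSet δ k ↔ (δ.symm i : ℕ) < k := by
  simp [prefixSet]

theorem prefixSet_zero (δ : Equiv.Perm (Fin n)) : prefixSet δ 0 = ∅ := by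
  ext i; simp [mem_prefixSet]

theorem prefixSet_self (δ : Equiv.Perm (Fin n)) : prefixSet δ n = Finset.univ := by
  ext i; simp [mem_prefixSet]

theorem prefixSet_succ (δ : Equiv.Perm (Fin n)) (k : Fin n) :
    prefixSet δ (k + 1) = insert (δ k) (prefixSet δ k) := by
  ext i
  simp only [mem_prefixSet, Finset.mem_insert, ← Equiv.symm_apply_eq, Fin.ext_iff]
  omega

theorem apply_notMem_prefixSet (δ : Equiv.Perm (Fin n)) (k : Fin n) :
    δ k ∉ prefixSet δ k := by
  simp [mem_prefixSet]

theorem image_Iio_eq_prefixSet (δ : Equiv.Perm (Fin n)) (k : Fin n) :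
    (Finset.Iio k).image δ = prefixSet δ k := by
  ext i
  simp only [Finset.mem_image, Finset.mem_Iio, mem_prefixSet]
  constructor
  · rintro ⟨a, ha, rfl⟩
    simpa using ha
  · intro h
    exact ⟨δ.symm i, h, by simp⟩

theorem greedy_apply (w : Finset (Fin n) → ℝ) (δ : Equiv.Perm (Fin n)) (k : Fin n) :
    greedy w δ (δ k) = w (prefixSet δ (k + 1)) - w (prefixSet δ k) := by
  simp [greedy]

theorem sum_greedy_prefixSet {w : Finset (Fin n) → ℝ} (h0 : w ∅ = 0) (δ : Equiv.Perm (Fin n))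
    (k : ℕ) (hk : k ≤ n) : ∑ i ∈ prefixSet δ k, greedy w δ i = w (prefixSet δ k) := by
  induction k with
  | zero => simp [prefixSet_zero, h0]
  | succ k ih =>
    have e := prefixSet_succ δ ⟨k, hk⟩
    have e' := apply_notMem_prefixSet δ ⟨k, hk⟩
    have e'' := greedy_apply w δ ⟨k, hk⟩
    simp only at e e' e''
    rw [e, Finset.sum_insert e', ih (by omega), e'', e]
    ring

/-- Diminishing returns: the next entry of `δ` adds at least as much to the part of the prefix
inside `I` as to the whole prefix. This makes the greedy point feasible. -/
theorem sum_greedy_inter_le {w : Finset (Fin n) → ℝ} (h0 : w ∅ = 0) (hw : IsSubmodular w)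
    (δ : Equiv.Perm (Fin n)) (I : Finset (Fin n)) (k : ℕ) (hk : k ≤ n) :
    ∑ i ∈ I ∩ prefixSet δ k, greedy w δ i ≤ w (I ∩ prefixSet δ k) := by
  induction k with
  | zero => simp [prefixSet_zero, h0]
  | succ k ih =>
    have e := prefixSet_succ δ ⟨k, hk⟩
    have e' := apply_notMem_prefixSet δ ⟨k, hk⟩
    have e'' := greedy_apply w δ ⟨k, hk⟩
    simp only at e e' e''
    specialize ih (by omega)
    by_cases hI : δ ⟨k, hk⟩ ∈ I
    · have key := hw (I ∩ prefixSet δ (k + 1)) (prefixSet δ k)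
      have a1 : I ∩ prefixSet δ (k + 1) ∩ prefixSet δ k = I ∩ prefixSet δ k := by
        rw [e]; grind
      have a2 : I ∩ prefixSet δ (k + 1) ∪ prefixSet δ k = prefixSet δ (k + 1) := by
        rw [e]; grind
      have a3 : I ∩ prefixSet δ (k + 1) = insert (δ ⟨k, hk⟩) (I ∩ prefixSet δ k) := by
        rw [e]; grind
      rw [a1, a2] at key
      have a4 : ∑ i ∈ I ∩ prefixSet δ (k + 1), greedy w δ i
          = greedy w δ (δ ⟨k, hk⟩) + ∑ i ∈ I ∩ prefixSet δ k, greedy w δ i := by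
        rw [a3, Finset.sum_insert (by grind)]
      linarith
    · have a3 : I ∩ prefixSet δ (k + 1) = I ∩ prefixSet δ k := by
        rw [e]; grind
      rwa [a3]

theorem greedy_mem_basePolytope {w : Finset (Fin n) → ℝ} (h0 : w ∅ = 0) (hw : IsSubmodular w)
    (δ : Equiv.Perm (Fin n)) : greedy w δ ∈ basePolytope w := by
  refine ⟨?_, fun I _ => ?_⟩
  · simpa [prefixSet_self] using sum_greedy_prefixSet h0 δ n le_rfl
  · simpa [prefixSet_self] using sum_greedy_inter_le h0 hw δ I n le_rfl

/-- Summation by parts along `δ`, with the case of equality. -/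
theorem le_sum_prefixSet {δ : Equiv.Perm (Fin n)} {u z : Fin n → ℝ} (hu : u ∈ chamber δ)
    (hz : ∀ k ≤ n, 0 ≤ ∑ i ∈ prefixSet δ k, z i) (k : ℕ) (hk : k < n) :
    u (δ ⟨k, hk⟩) * ∑ i ∈ prefixSet δ (k + 1), z i ≤ ∑ i ∈ prefixSet δ (k + 1), u i * z i ∧
      (IsDescentVector u δ →
        u (δ ⟨k, hk⟩) * ∑ i ∈ prefixSet δ (k + 1), z i = ∑ i ∈ prefixSet δ (k + 1), u i * z i →
        ∀ j ≤ k, ∑ i ∈ prefixSet δ j, z i = 0) := by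
  induction k with
  | zero =>
    have e := prefixSet_succ δ ⟨0, hk⟩
    simp only [prefixSet_zero] at e
    rw [e]
    simp [prefixSet_zero]
  | succ k ih =>
    obtain ⟨i1, i2⟩ := ih (by omega)
    have e := prefixSet_succ δ ⟨k + 1, hk⟩
    have e' := apply_notMem_prefixSet δ ⟨k + 1, hk⟩
    simp only at e e'
    rw [e, Finset.sum_insert e', Finset.sum_insert e']
    have hz' := hz (k + 1) (by omega)
    have hu' : u (δ ⟨k + 1, hk⟩) ≤ u (δ ⟨k, by omega⟩) := hu (by simp [Fin.le_def])
    have := mul_le_mul_of_nonneg_right hu' hz'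
    refine ⟨by linarith, fun hd heq j hj => ?_⟩
    have hd' : u (δ ⟨k + 1, hk⟩) < u (δ ⟨k, by omega⟩) := hd (by simp [Fin.lt_def])
    rcases Nat.lt_or_eq_of_le hj with hj | rfl
    · exact i2 hd (by linarith) j (by omega)
    · have : (u (δ ⟨k, by omega⟩) - u (δ ⟨k + 1, hk⟩)) * ∑ i ∈ prefixSet δ (k + 1), z i = 0 := by
        linarith
      exact (mul_eq_zero.1 this).resolve_left (by linarith)

theorem eq_zero_of_sum_prefixSet {δ : Equiv.Perm (Fin n)} {z : Fin n → ℝ}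
    (hz : ∀ k ≤ n, ∑ i ∈ prefixSet δ k, z i = 0) : z = 0 := by
  funext i
  obtain ⟨k, rfl⟩ := δ.surjective i
  have h := hz (k + 1) k.2
  rw [prefixSet_succ, Finset.sum_insert (apply_notMem_prefixSet δ k), hz k k.2.le] at h
  simpa using h

/-- Meant for `z` an optimal point minus a competitor: the first part gives optimality throughout
the chamber, the second gives uniqueness in its interior. -/
theorem dotProduct_nonneg_of_prefixSet {δ : Equiv.Perm (Fin n)} {u z : Fin n → ℝ}
    (hu : u ∈ chamber δ) (hz : ∀ k ≤ n, 0 ≤ ∑ i ∈ prefixSet δ k, z i) (hz' : ∑ i, z i = 0) :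
    0 ≤ u ⬝ᵥ z ∧ (IsDescentVector u δ → u ⬝ᵥ z = 0 → z = 0) := by
  rcases n with _ | n
  · exact ⟨by simp [dotProduct], fun _ _ => Subsingleton.elim _ _⟩
  obtain ⟨h1, h2⟩ := le_sum_prefixSet hu hz n n.lt_succ_self
  rw [prefixSet_self, hz', mul_zero] at h1 h2
  refine ⟨h1, fun hd h => eq_zero_of_sum_prefixSet (δ := δ) fun k hk => ?_⟩
  rcases Nat.lt_or_eq_of_le hk with hk | rfl
  · exact h2 hd h.symm k (by omega)
  · rw [prefixSet_self, hz']

theorem IsDescentVector.mem_chamber {u : Fin n → ℝ} {δ : Equiv.Perm (Fin n)}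
    (h : IsDescentVector u δ) : u ∈ chamber δ :=
  h.antitone

theorem exists_isDescentVector (δ : Equiv.Perm (Fin n)) : ∃ u, IsDescentVector u δ :=
  ⟨fun i => -((δ.symm i : ℕ) : ℝ), fun a b h => by simpa using h⟩

theorem exists_mem_chamber (u : Fin n → ℝ) : ∃ δ, u ∈ chamber δ := by
  refine ⟨Tuple.sort (fun i => -u i), fun a b h => ?_⟩
  have := Tuple.monotone_sort (fun i => -u i) h
  simpa using this

theorem sum_sub_prefixSet_nonneg {w : Finset (Fin n) → ℝ} (h0 : w ∅ = 0)
    (δ : Equiv.Perm (Fin n)) {y : Fin n → ℝ} (hy : y ∈ basePolytope w) (k : ℕ) (hk : k ≤ n) :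
    0 ≤ ∑ i ∈ prefixSet δ k, (greedy w δ - y) i := by
  simp only [Pi.sub_apply, Finset.sum_sub_distrib]
  rw [sum_greedy_prefixSet h0 δ k hk]
  rcases (prefixSet δ k).eq_empty_or_nonempty with h | h
  · simp [h, h0]
  · linarith [hy.2 _ h]

theorem greedy_mem_maximizers {w : Finset (Fin n) → ℝ} (h0 : w ∅ = 0) (hw : IsSubmodular w)
    {δ : Equiv.Perm (Fin n)} {u : Fin n → ℝ} (hu : u ∈ chamber δ) :
    greedy w δ ∈ maximizers (basePolytope w) u := by
  have hg := greedy_mem_basePolytope h0 hw δ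
  refine ⟨hg, fun y hy => ?_⟩
  have := (dotProduct_nonneg_of_prefixSet hu (sum_sub_prefixSet_nonneg h0 δ hy)
    (by simp [hg.1, hy.1])).1
  rw [dotProduct_sub] at this
  linarith

theorem maximizers_eq_greedy {w : Finset (Fin n) → ℝ} (h0 : w ∅ = 0) (hw : IsSubmodular w)
    {δ : Equiv.Perm (Fin n)} {u : Fin n → ℝ} (hu : IsDescentVector u δ) :
    maximizers (basePolytope w) u = {greedy w δ} := by
  have hg := greedy_mem_maximizers h0 hw hu.mem_chamber
  refine Set.Subset.antisymm (fun y hy => ?_) (Set.singleton_subset_iff.2 hg)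
  have h := (dotProduct_nonneg_of_prefixSet hu.mem_chamber (sum_sub_prefixSet_nonneg h0 δ hy.1)
    (by simp [hg.1.1, hy.1.1])).2 hu
    (by rw [dotProduct_sub]; linarith [hy.2 _ hg.1, hg.2 _ hy.1])
  exact (sub_eq_zero.1 h).symm

/-- The rank test of `w`: compare greedy vertices. -/
def greedyTest (w : Finset (Fin n) → ℝ) : Setoid (Equiv.Perm (Fin n)) :=
  Setoid.ker (greedy w)

theorem isTestOf_greedyTest {w : Finset (Fin n) → ℝ} (h0 : w ∅ = 0) (hw : IsSubmodular w) :
    IsTestOf (greedyTest w) w := by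
  intro u v δ ε hu hv
  rw [maximizers_eq_greedy h0 hw hu, maximizers_eq_greedy h0 hw hv, Set.singleton_eq_singleton_iff]
  rfl

theorem IsTestOf.eq_greedyTest {w : Finset (Fin n) → ℝ} (h0 : w ∅ = 0) (hw : IsSubmodular w)
    {τ : Setoid (Equiv.Perm (Fin n))} (h : IsTestOf τ w) : τ = greedyTest w := by
  refine Setoid.ext fun δ ε => ?_
  obtain ⟨u, hu⟩ := exists_isDescentVector δ
  obtain ⟨v, hv⟩ := exists_isDescentVector ε
  exact (h u v δ ε hu hv).trans (isTestOf_greedyTest h0 hw u v δ ε hu hv).symm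

/-! ### The base polytope as a convex hull -/

theorem convex_basePolytope (w : Finset (Fin n) → ℝ) : Convex ℝ (basePolytope w) := by
  rintro x hx y hy a b ha hb hab
  simp only [basePolytope, Set.mem_ofPred_eq, Pi.add_apply, Pi.smul_apply, smul_eq_mul,
    Finset.sum_add_distrib, ← Finset.mul_sum]
  refine ⟨by rw [hx.1, hy.1, ← add_mul, hab, one_mul], fun I hI => ?_⟩
  calc _ ≤ a * w I + b * w I := by
        gcongr
        exacts [hx.2 I hI, hy.2 I hI]
    _ = w I := by rw [← add_mul, hab, one_mul]

theorem exists_dotProduct_lt_of_notMem_convexHull {ι : Type} [Fintype ι] {S : Set (ι → ℝ)}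
    (hS : S.Finite) {y : ι → ℝ} (hy : y ∉ convexHull ℝ S) :
    ∃ u : ι → ℝ, ∀ x ∈ S, u ⬝ᵥ x < u ⬝ᵥ y := by
  classical
  obtain ⟨f, s, h1, h2⟩ := geometric_hahn_banach_closed_point (convex_convexHull ℝ S)
    (hS.isClosed_convexHull ℝ) hy
  have hf : ∀ x, f x = (fun i => f (Pi.single i 1)) ⬝ᵥ x := by
    intro x
    conv_lhs => rw [pi_eq_sum_univ' x]
    simp [dotProduct, mul_comm]
  refine ⟨fun i => f (Pi.single i 1), fun x hx => ?_⟩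
  rw [← hf, ← hf]
  exact (h1 x (subset_convexHull ℝ S hx)).trans h2

/-- A functional separating a point of `Q_w` from the hull lies in some chamber, where a greedy
vertex is already optimal. -/
theorem basePolytope_eq_convexHull {w : Finset (Fin n) → ℝ} (h0 : w ∅ = 0)
    (hw : IsSubmodular w) : basePolytope w = convexHull ℝ (Set.range (greedy w)) := by
  refine Set.Subset.antisymm (fun y hy => ?_) (convexHull_min ?_ (convex_basePolytope w))
  · by_contra hc
    obtain ⟨u, hu⟩ := exists_dotProduct_lt_of_notMem_convexHull (Set.finite_range _) hc
    obtain ⟨δ, hδ⟩ := exists_mem_chamber u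
    exact absurd ((greedy_mem_maximizers h0 hw hδ).2 y hy) (not_le.2 (hu _ ⟨δ, rfl⟩))
  · rintro _ ⟨δ, rfl⟩
    exact greedy_mem_basePolytope h0 hw δ

theorem isPolytope_basePolytope {w : Finset (Fin n) → ℝ} (h0 : w ∅ = 0)
    (hw : IsSubmodular w) : IsPolytope (basePolytope w) :=
  ⟨_, Set.finite_range _, Set.range_nonempty _, basePolytope_eq_convexHull h0 hw⟩

/-! ### Permutations with prescribed prefixes -/

theorem card_prefixSet (δ : Equiv.Perm (Fin n)) (k : ℕ) (hk : k ≤ n) :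
    (prefixSet δ k).card = k := by
  induction k with
  | zero => simp [prefixSet_zero]
  | succ k ih =>
    have e := prefixSet_succ δ ⟨k, hk⟩
    have e' := apply_notMem_prefixSet δ ⟨k, hk⟩
    simp only at e e'
    rw [e, Finset.card_insert_of_notMem e', ih (by omega)]

/-- Sorting a step function whose superlevel sets are given nested sets turns those sets into
prefixes. -/
theorem exists_filter_eq_prefixSet {u : Fin n → ℝ} {δ : Equiv.Perm (Fin n)} (hu : u ∈ chamber δ)
    (t : ℝ) : ∃ k ≤ n, Finset.univ.filter (fun i => t ≤ u i) = prefixSet δ k := by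
  -- One more than the last position in the set; an empty set gives length 0.
  refine ⟨(Finset.univ.filter (fun i => t ≤ u i)).sup fun i => (δ.symm i : ℕ) + 1,
    Finset.sup_le fun i _ => (δ.symm i).2, ?_⟩
  ext i
  rw [mem_prefixSet, Finset.lt_sup_iff]
  constructor
  · exact fun hi => ⟨i, hi, Nat.lt_succ_self _⟩
  · rintro ⟨j, hj, hij⟩
    have : u (δ (δ.symm j)) ≤ u (δ (δ.symm i)) := hu (Fin.le_def.2 (by omega))
    simp only [Equiv.apply_symm_apply] at this
    simp only [Finset.mem_filter, Finset.mem_univ, true_and] at hj ⊢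
    exact hj.trans this

/-- Any two nested sets are prefixes of a common permutation. -/
theorem exists_prefixSet_of_subset {I J : Finset (Fin n)} (h : I ⊆ J) :
    ∃ δ : Equiv.Perm (Fin n), (∃ k ≤ n, I = prefixSet δ k) ∧ ∃ k ≤ n, J = prefixSet δ k := by
  obtain ⟨δ, hδ⟩ := exists_mem_chamber
    (fun i => if i ∈ I then 2 else if i ∈ J then 1 else 0 : Fin n → ℝ)
  obtain ⟨a, ha, ha'⟩ := exists_filter_eq_prefixSet hδ 2
  obtain ⟨b, hb, hb'⟩ := exists_filter_eq_prefixSet hδ 1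
  refine ⟨δ, ⟨a, ha, ?_⟩, ⟨b, hb, ?_⟩⟩
  · rw [← ha']; ext i
    by_cases h1 : i ∈ I
    · simp [h1]
    · by_cases h2 : i ∈ J <;> simp [h1, h2]
  · rw [← hb']; ext i
    by_cases h1 : i ∈ I
    · simp [h1, h h1]
    · by_cases h2 : i ∈ J <;> simp [h1, h2]

theorem exists_wallLabel_eq {i j : Fin n} {K : Finset (Fin n)} (hij : i ≠ j) (hi : i ∉ K)
    (hj : j ∉ K) : ∃ (δ : Equiv.Perm (Fin n)) (k l : Fin n), (k : ℕ) + 1 = (l : ℕ) ∧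
      wallLabel δ k l = ({i}, {j}, K) := by
  obtain ⟨δ, hδ⟩ := exists_mem_chamber
    (fun m => if m ∈ K then 3 else if m = i then 2 else if m = j then 1 else 0 : Fin n → ℝ)
  obtain ⟨a, ha, ha'⟩ := exists_filter_eq_prefixSet hδ 3
  obtain ⟨b, hb, hb'⟩ := exists_filter_eq_prefixSet hδ 2
  obtain ⟨c, hc, hc'⟩ := exists_filter_eq_prefixSet hδ 1
  have ea : prefixSet δ a = K := by
    rw [← ha']; ext m
    by_cases h1 : m ∈ K
    · simp [h1]
    · by_cases h2 : m = i <;> by_cases h3 : m = j <;> simp [h1, h2, h3] <;> grind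
  have eb : prefixSet δ b = insert i K := by
    rw [← hb']; ext m
    by_cases h1 : m ∈ K
    · simp [h1]; norm_num
    · by_cases h2 : m = i <;> by_cases h3 : m = j <;> simp [h1, h2, h3] <;> grind
  have ec : prefixSet δ c = insert j (insert i K) := by
    rw [← hc']; ext m
    by_cases h1 : m ∈ K
    · simp [h1]
    · by_cases h2 : m = i <;> by_cases h3 : m = j <;> simp [h1, h2, h3] <;> grind
  -- Cardinalities force the three prefix lengths to be `a`, `a + 1`, `a + 2`, so `i` and `j`
  -- directly follow `K`.
  have ca := card_prefixSet δ a ha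
  have cb := card_prefixSet δ b hb
  have cc := card_prefixSet δ c hc
  rw [ea] at ca
  rw [eb, Finset.card_insert_of_notMem hi, ca] at cb
  rw [ec, Finset.card_insert_of_notMem (by grind), Finset.card_insert_of_notMem hi, ca] at cc
  subst cb cc
  have hk := prefixSet_succ δ ⟨a, hb⟩
  have hl := prefixSet_succ δ ⟨a + 1, hc⟩
  have nk := apply_notMem_prefixSet δ ⟨a, hb⟩
  have nl := apply_notMem_prefixSet δ ⟨a + 1, hc⟩
  simp only [ea, eb, ec] at hk hl nk nl
  refine ⟨δ, ⟨a, hb⟩, ⟨a + 1, hc⟩, rfl, ?_⟩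
  have e1 : δ ⟨a, hb⟩ = i := by
    have : δ ⟨a, hb⟩ ∈ insert i K := by rw [hk]; exact Finset.mem_insert_self _ _
    grind
  have e2 : δ ⟨a + 1, hc⟩ = j := by
    have : δ ⟨a + 1, hc⟩ ∈ insert j (insert i K) := by rw [hl]; exact Finset.mem_insert_self _ _
    grind
  rw [wallLabel, image_Iio_eq_prefixSet, e1, e2, ea]

/-! ### Points that are optimal on a whole chamber -/

theorem indicator_dotProduct (I : Finset (Fin n)) (y : Fin n → ℝ) :
    (fun i => if i ∈ I then 1 else 0 : Fin n → ℝ) ⬝ᵥ y = ∑ i ∈ I, y i := by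
  simp [dotProduct]

theorem indicator_prefixSet_mem_chamber (δ : Equiv.Perm (Fin n)) (k : ℕ) :
    (fun i => if i ∈ prefixSet δ k then 1 else 0 : Fin n → ℝ) ∈ chamber δ := by
  intro a b hab
  have : (a : ℕ) ≤ b := hab
  simp only [mem_prefixSet, Equiv.symm_apply_apply]
  split_ifs <;> first | omega | norm_num

theorem const_mem_chamber (δ : Equiv.Perm (Fin n)) (c : ℝ) : (fun _ => c) ∈ chamber δ :=
  fun _ _ _ => le_rfl

theorem sum_prefixSet_le_of_chamber {P : Set (Fin n → ℝ)} {δ : Equiv.Perm (Fin n)} {x y : Fin n → ℝ}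
    (h : ∀ u ∈ chamber δ, y ∈ maximizers P u) (hx : x ∈ P) (k : ℕ) :
    ∑ i ∈ prefixSet δ k, x i ≤ ∑ i ∈ prefixSet δ k, y i := by
  have := (h _ (indicator_prefixSet_mem_chamber δ k)).2 x hx
  rwa [indicator_dotProduct, indicator_dotProduct] at this

/-- A chamber contains the constants of both signs. -/
theorem sum_eq_of_chamber {P : Set (Fin n → ℝ)} {δ : Equiv.Perm (Fin n)} {x y : Fin n → ℝ}
    (h : ∀ u ∈ chamber δ, y ∈ maximizers P u) (hx : x ∈ P) : ∑ i, x i = ∑ i, y i := by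
  have h1 := (h _ (const_mem_chamber δ 1)).2 x hx
  have h2 := (h _ (const_mem_chamber δ (-1))).2 x hx
  simp only [dotProduct, ← Finset.mul_sum] at h1 h2
  linarith

theorem maximizers_eq_singleton_of_chamber {P : Set (Fin n → ℝ)} {δ : Equiv.Perm (Fin n)}
    {u y : Fin n → ℝ} (h : ∀ u ∈ chamber δ, y ∈ maximizers P u) (hu : IsDescentVector u δ) :
    maximizers P u = {y} := by
  have hy := h u hu.mem_chamber
  refine Set.Subset.antisymm (fun x hx => ?_) (Set.singleton_subset_iff.2 hy)
  have key := (dotProduct_nonneg_of_prefixSet (z := y - x) hu.mem_chamber (fun k _ => by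
      simpa using sum_prefixSet_le_of_chamber h hx.1 k)
    (by simp [sum_eq_of_chamber h hx.1])).2 hu
    (by rw [dotProduct_sub]; linarith [hx.2 _ hy.1, hy.2 _ hx.1])
  exact (sub_eq_zero.1 key).symm

/-! ### The normal fan of the permutohedron -/

/-- The vertex of the permutohedron that maximizes the functionals in the chamber of `δ`. -/
def rankVector (δ : Equiv.Perm (Fin n)) (i : Fin n) : ℝ :=
  (((δ.symm.trans Fin.revPerm) i : ℕ) : ℝ) + 1

theorem rankVector_mem (δ : Equiv.Perm (Fin n)) : rankVector δ ∈ permutohedron n :=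
  subset_convexHull ℝ _ ⟨δ.symm.trans Fin.revPerm, rfl⟩

theorem monovary_rankVector_iff {δ : Equiv.Perm (Fin n)} {u : Fin n → ℝ} :
    Monovary u (rankVector δ) ↔ u ∈ chamber δ := by
  have key : ∀ i j, rankVector δ i < rankVector δ j ↔ δ.symm j < δ.symm i := by
    intro i j
    simp [rankVector]
  constructor
  · intro h a b hab
    rcases hab.eq_or_lt with rfl | hab
    · exact le_rfl
    · exact h ((key _ _).2 (by simpa using hab))
  · intro h i j hij
    have := h ((key _ _).1 hij).le
    simpa using this

/-- This is the rearrangement inequality; its case of equality shows that no functional outside the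
chamber is maximized at this vertex. -/
theorem rankVector_mem_maximizers_iff {δ : Equiv.Perm (Fin n)} {u : Fin n → ℝ} :
    rankVector δ ∈ maximizers (permutohedron n) u ↔ u ∈ chamber δ := by
  constructor
  · intro h
    obtain ⟨ε, hε⟩ := exists_mem_chamber u
    have hm := monovary_rankVector_iff.2 hε
    have hσ : rankVector δ = rankVector ε ∘ (δ.symm.trans ε) := by
      funext i; simp [rankVector]
    have h1 := h.2 _ (rankVector_mem ε)
    rw [← monovary_rankVector_iff, hσ, ← hm.sum_mul_comp_perm_eq_sum_mul_iff]
    refine le_antisymm hm.sum_mul_comp_perm_le_sum_mul ?_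
    rw [hσ] at h1
    exact h1
  · intro hu
    have hm := monovary_rankVector_iff.2 hu
    refine ⟨rankVector_mem δ, ?_⟩
    have : permutohedron n ⊆ {y | u ⬝ᵥ y ≤ u ⬝ᵥ rankVector δ} := by
      refine convexHull_min ?_ ?_
      · rintro _ ⟨ρ, rfl⟩
        have hσ : (fun i => ((ρ i : ℕ) : ℝ) + 1)
            = rankVector δ ∘ (ρ.trans (Fin.revPerm.trans δ)) := by
          funext i; simp [rankVector]
        beta_reduce
        rw [hσ]
        exact hm.sum_mul_comp_perm_le_sum_mul
      · intro x hx y hy a b ha hb hab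
        simp only [Set.mem_ofPred_eq, dotProduct_add, dotProduct_smul, smul_eq_mul] at hx hy ⊢
        calc _ ≤ a * (u ⬝ᵥ rankVector δ) + b * (u ⬝ᵥ rankVector δ) := by gcongr
          _ = _ := by rw [← add_mul, hab, one_mul]
    exact fun y hy => this hy

/-- With `exists_chamber_subset`, this reduces refinement by the permutohedron's fan to every
chamber lying in some cone. -/
theorem exists_subset_chamber {C : Set (Fin n → ℝ)} (hC : C ∈ normalFan (permutohedron n)) :
    ∃ δ, C ⊆ chamber δ := by
  obtain ⟨F, ⟨-, c, rfl⟩, rfl⟩ := hC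
  obtain ⟨δ, hδ⟩ := exists_mem_chamber c
  exact ⟨δ, fun u hu => rankVector_mem_maximizers_iff.1
    (hu (rankVector_mem_maximizers_iff.2 hδ))⟩

theorem exists_chamber_subset (δ : Equiv.Perm (Fin n)) :
    ∃ C ∈ normalFan (permutohedron n), chamber δ ⊆ C := by
  obtain ⟨u, hu⟩ := exists_isDescentVector δ
  have h : ∀ u ∈ chamber δ, rankVector δ ∈ maximizers (permutohedron n) u :=
    fun u hu => rankVector_mem_maximizers_iff.2 hu
  exact ⟨_, ⟨{rankVector δ}, ⟨Set.singleton_nonempty _, u,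
    (maximizers_eq_singleton_of_chamber h hu).symm⟩, rfl⟩,
    fun v hv => Set.singleton_subset_iff.2 (h v hv)⟩

/-! ### Summands -/

theorem normalCone_greedy_mem {w : Finset (Fin n) → ℝ} (h0 : w ∅ = 0) (hw : IsSubmodular w)
    (δ : Equiv.Perm (Fin n)) :
    normalCone (basePolytope w) {greedy w δ} ∈ normalFan (basePolytope w) := by
  obtain ⟨u, hu⟩ := exists_isDescentVector δ
  exact ⟨_, ⟨Set.singleton_nonempty _, u, (maximizers_eq_greedy h0 hw hu).symm⟩, rfl⟩

theorem chamber_subset_normalCone {w : Finset (Fin n) → ℝ} (h0 : w ∅ = 0) (hw : IsSubmodular w)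
    (δ : Equiv.Perm (Fin n)) : chamber δ ⊆ normalCone (basePolytope w) {greedy w δ} :=
  fun _ hu => Set.singleton_subset_iff.2 (greedy_mem_maximizers h0 hw hu)

theorem isSummand_basePolytope {w : Finset (Fin n) → ℝ} (h0 : w ∅ = 0) (hw : IsSubmodular w) :
    IsSummand n (basePolytope w) := by
  refine ⟨isPolytope_basePolytope h0 hw, fun C hC => ?_⟩
  obtain ⟨δ, hδ⟩ := exists_subset_chamber hC
  exact ⟨_, normalCone_greedy_mem h0 hw δ, hδ.trans (chamber_subset_normalCone h0 hw δ)⟩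

theorem isInducedBy_greedyTest {w : Finset (Fin n) → ℝ} (h0 : w ∅ = 0) (hw : IsSubmodular w) :
    IsInducedBy (greedyTest w) (normalFan (basePolytope w)) := by
  intro δ ε
  constructor
  · intro h
    have h : greedy w δ = greedy w ε := h
    refine ⟨_, normalCone_greedy_mem h0 hw δ, chamber_subset_normalCone h0 hw δ, ?_⟩
    rw [h]
    exact chamber_subset_normalCone h0 hw ε
  · rintro ⟨D, ⟨F, ⟨⟨y, hy⟩, -⟩, rfl⟩, h1, h2⟩
    -- A functional in the interior of the chamber has only one maximizer, so it determines the
    -- point `y` of the face.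
    have key : ∀ δ, chamber δ ⊆ normalCone (basePolytope w) F → y = greedy w δ := by
      intro δ h
      obtain ⟨u, hu⟩ := exists_isDescentVector δ
      have := h hu.mem_chamber hy
      rwa [maximizers_eq_greedy h0 hw hu] at this
    exact (key δ h1).symm.trans (key ε h2)

theorem IsInducedBy.eq {σ τ : Setoid (Equiv.Perm (Fin n))} {G : Set (Set (Fin n → ℝ))}
    (hσ : IsInducedBy σ G) (hτ : IsInducedBy τ G) : σ = τ :=
  Setoid.ext fun δ ε => (hσ δ ε).trans (hτ δ ε).symm

/-- Every summand of the permutohedron is the base polytope of a submodular function. -/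
theorem IsSummand.exists_basePolytope_eq {Q : Set (Fin n → ℝ)} (hQ : IsSummand n Q) :
    ∃ w : Finset (Fin n) → ℝ, IsSubmodular w ∧ w ∅ = 0 ∧ basePolytope w = Q := by
  have hconv : Convex ℝ Q := by
    obtain ⟨⟨S, -, -, rfl⟩, -⟩ := hQ
    exact convex_convexHull ℝ S
  have hy : ∀ δ : Equiv.Perm (Fin n), ∃ y, ∀ u ∈ chamber δ, y ∈ maximizers Q u := by
    intro δ
    obtain ⟨C, hC, hδ⟩ := exists_chamber_subset δ
    obtain ⟨_, ⟨F, ⟨⟨y, hy⟩, -⟩, rfl⟩, hD⟩ := hQ.2 C hC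
    exact ⟨y, fun u hu => hD (hδ hu) hy⟩
  choose y hy using hy
  have hyQ : ∀ δ, y δ ∈ Q := fun δ => (hy δ _ (const_mem_chamber δ 0)).1
  have hI : ∀ I : Finset (Fin n), ∃ δ : Equiv.Perm (Fin n), ∃ k ≤ n, I = prefixSet δ k :=
    fun I => (exists_prefixSet_of_subset (Finset.Subset.refl I)).imp fun _ h => h.1
  choose d p hp hd using hI
  -- The maximum over `Q` of the coordinate sum on `I`, read off at a permutation that has `I` as a
  -- prefix; `hwp` shows that any such permutation gives the same value.
  let w : Finset (Fin n) → ℝ := fun I => ∑ i ∈ I, y (d I) i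
  have hle : ∀ I, ∀ x ∈ Q, ∑ i ∈ I, x i ≤ w I := by
    intro I x hx
    have := sum_prefixSet_le_of_chamber (hy (d I)) hx (p I)
    rwa [← hd I] at this
  have hwp : ∀ δ k, w (prefixSet δ k) = ∑ i ∈ prefixSet δ k, y δ i := fun δ k =>
    le_antisymm (sum_prefixSet_le_of_chamber (hy δ) (hyQ _) k) (hle _ _ (hyQ δ))
  have h0 : w ∅ = 0 := Finset.sum_empty
  have hw : IsSubmodular w := by
    intro I J
    -- The maxima for `I ∩ J` and `I ∪ J` are attained at the same point `y δ`, where coordinate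
    -- sums are modular.
    obtain ⟨δ, ⟨a, -, ha⟩, ⟨b, -, hb⟩⟩ :=
      exists_prefixSet_of_subset (I := I ∩ J) (J := I ∪ J) (by grind)
    rw [ha, hb, hwp, hwp, ← ha, ← hb, add_comm, Finset.sum_union_inter]
    exact add_le_add (hle _ _ (hyQ δ)) (hle _ _ (hyQ δ))
  have hgr : ∀ δ, greedy w δ = y δ := by
    intro δ
    rw [← sub_eq_zero]
    refine eq_zero_of_sum_prefixSet (δ := δ) fun k hk => ?_
    simp [sum_greedy_prefixSet h0 δ k hk, hwp]
  refine ⟨w, hw, h0, Set.Subset.antisymm ?_ fun x hx => ⟨?_, fun I _ => hle I x hx⟩⟩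
  · rw [basePolytope_eq_convexHull h0 hw]
    refine convexHull_min ?_ hconv
    rintro _ ⟨δ, rfl⟩
    rw [hgr]
    exact hyQ δ
  · exact sum_eq_of_chamber (hy _) hx

/-! ### Walls between chambers -/

/-- Crossing a wall between chambers fixes the greedy vertex iff the wall label holds. -/
theorem wallLabel_mem_functionModel_iff (w : Finset (Fin n) → ℝ) (δ : Equiv.Perm (Fin n))
    {k l : Fin n} (hkl : (k : ℕ) + 1 = l) :
    wallLabel δ k l ∈ functionModel w ↔ greedyTest w δ (δ * Equiv.swap k l) := by
  have hne : k ≠ l := by rintro rfl; omega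
  have hne' : δ k ≠ δ l := δ.injective.ne hne
  have hk : δ k ∉ prefixSet δ k := apply_notMem_prefixSet δ k
  have hl : δ l ∉ prefixSet δ k := by simp [mem_prefixSet, ← hkl]
  have hsymm : ∀ i, (δ * Equiv.swap k l).symm i = Equiv.swap k l (δ.symm i) := fun i => rfl
  -- The exchange changes only the prefix of length `l = k + 1`, hence at most the coordinates at `δ
  -- k` and `δ l`.
  have hpre : ∀ m : ℕ, m ≠ l → prefixSet (δ * Equiv.swap k l) m = prefixSet δ m := by
    intro m hm
    ext i
    rw [mem_prefixSet, mem_prefixSet, hsymm]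
    rcases eq_or_ne (δ.symm i) k with h | h
    · rw [h, Equiv.swap_apply_left]; omega
    · rcases eq_or_ne (δ.symm i) l with h' | h'
      · rw [h', Equiv.swap_apply_right]; omega
      · rw [Equiv.swap_apply_of_ne_of_ne h h']
  have p1 : prefixSet δ l = insert (δ k) (prefixSet δ k) := by rw [← hkl, prefixSet_succ]
  have p2 : prefixSet δ (l + 1) = insert (δ l) (insert (δ k) (prefixSet δ k)) := by
    rw [prefixSet_succ, p1]
  have q1 : prefixSet (δ * Equiv.swap k l) l = insert (δ l) (prefixSet δ k) := by
    rw [← hkl, prefixSet_succ, hpre _ (by omega)]; simp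
  have q2 : prefixSet (δ * Equiv.swap k l) (l + 1)
      = insert (δ l) (insert (δ k) (prefixSet δ k)) := by
    rw [hpre _ (by omega), p2]
  have gk : greedy w δ (δ k) = w (insert (δ k) (prefixSet δ k)) - w (prefixSet δ k) := by
    rw [greedy_apply, prefixSet_succ]
  have gl : greedy w δ (δ l) = w (insert (δ l) (insert (δ k) (prefixSet δ k)))
      - w (insert (δ k) (prefixSet δ k)) := by
    rw [greedy_apply, p2, p1]
  have gk' : greedy w (δ * Equiv.swap k l) (δ k)
      = w (insert (δ l) (insert (δ k) (prefixSet δ k))) - w (insert (δ l) (prefixSet δ k)) := by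
    have : δ k = (δ * Equiv.swap k l) l := by simp
    rw [this, greedy_apply, q2, q1]
    simp
  have gl' : greedy w (δ * Equiv.swap k l) (δ l)
      = w (insert (δ l) (prefixSet δ k)) - w (prefixSet δ k) := by
    have : δ l = (δ * Equiv.swap k l) k := by simp
    rw [this, greedy_apply, hkl, q1, hpre _ (by omega)]
    simp
  have hmem : wallLabel δ k l ∈ functionModel w ↔
      w (insert (δ k) (prefixSet δ k)) + w (insert (δ l) (prefixSet δ k))
        = w (insert (δ l) (insert (δ k) (prefixSet δ k))) + w (prefixSet δ k) := by
    rw [wallLabel, image_Iio_eq_prefixSet]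
    simp only [functionModel, IsDisjointTriple, Set.mem_ofPred_eq, Finset.disjoint_singleton_left,
      Finset.mem_singleton, hne', hk, hl, not_false_eq_true, true_and, and_self]
    have : ({δ k} ∪ {δ l} ∪ prefixSet δ k : Finset (Fin n))
        = insert (δ l) (insert (δ k) (prefixSet δ k)) := by ext; simp; tauto
    rw [this]; rfl
  rw [hmem]
  constructor
  · intro h
    show greedy w δ = greedy w (δ * Equiv.swap k l)
    funext i
    obtain ⟨m, rfl⟩ := δ.surjective i
    rcases eq_or_ne m k with rfl | h1
    · rw [gk, gk']; linarith
    · rcases eq_or_ne m l with rfl | h2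
      · rw [gl, gl']; linarith
      · have : δ m = (δ * Equiv.swap k l) m := by
          simp [Equiv.swap_apply_of_ne_of_ne h1 h2]
        rw [greedy_apply, this, greedy_apply, hpre m (by omega), hpre (m + 1) (by omega)]
  · intro h
    have := congrFun (show greedy w δ = greedy w (δ * Equiv.swap k l) from h) (δ k)
    rw [gk, gk'] at this
    linarith

/-! ### Farkas' lemma, rational and integral -/

/-- Farkas' lemma over an ordered field, for finitely many linear functionals. -/
theorem mem_cone_of_forall_nonpos {K V ι : Type*} [Field K] [LinearOrder K] [IsStrictOrderedRing K]
    [AddCommGroup V] [Module K V] (s : Finset ι) : ∀ (a : ι → V →ₗ[K] K) (b : V →ₗ[K] K),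
    (∀ x, (∀ i ∈ s, a i x ≤ 0) → b x ≤ 0) →
      ∃ c : ι → K, (∀ i ∈ s, 0 ≤ c i) ∧ b = ∑ i ∈ s, c i • a i := by
  classical
  induction s using Finset.induction_on with
  | empty =>
    intro a b h
    refine ⟨0, by simp, ?_⟩
    ext x
    have h1 := h x (by simp)
    have h2 := h (-x) (by simp)
    rw [map_neg] at h2
    simp only [Finset.sum_empty, LinearMap.zero_apply]
    linarith
  | insert j s hj ih =>
    intro a b h
    by_cases hb : ∀ x, (∀ i ∈ s, a i x ≤ 0) → b x ≤ 0
    · obtain ⟨c, hc, hb⟩ := ih a b hb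
      refine ⟨Function.update c j 0, fun i hi => ?_, ?_⟩
      · by_cases hij : i = j
        · simp [hij]
        · rw [Function.update_of_ne hij]
          exact hc i (Finset.mem_of_mem_insert_of_ne hi hij)
      · rw [Finset.sum_insert hj, hb]
        simp only [Function.update_self, zero_smul, zero_add]
        refine Finset.sum_congr rfl fun i hi => ?_
        rw [Function.update_of_ne (by rintro rfl; exact hj hi)]
    · push Not at hb
      obtain ⟨x₁, hx₁, hbx₁⟩ := hb
      have hjx : 0 < a j x₁ := by
        by_contra! hc
        refine absurd (h x₁ fun i hi => ?_) (not_le.2 hbx₁)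
        rcases Finset.mem_insert.1 hi with rfl | hi
        exacts [hc, hx₁ i hi]
      obtain ⟨x₀, hx₀, hbx₀, hjx₀⟩ : ∃ x, (∀ i ∈ s, a i x ≤ 0) ∧ 0 < b x ∧ a j x = 1 := by
        refine ⟨(a j x₁)⁻¹ • x₁, fun i hi => ?_, ?_, ?_⟩
        · rw [map_smul, smul_eq_mul]
          exact mul_nonpos_of_nonneg_of_nonpos (inv_nonneg.2 hjx.le) (hx₁ i hi)
        · rw [map_smul, smul_eq_mul]; positivity
        · rw [map_smul, smul_eq_mul, inv_mul_cancel₀ hjx.ne']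
      -- Every functional is composed with the projection `x ↦ x - a j x • x₀` onto the kernel of `a
      -- j`, which removes the constraint `j`. The coefficient of `a j` recovered below is
      -- nonnegative since `b x₀ > 0` and `a i x₀ ≤ 0` on `s`.
      obtain ⟨c, hc, hbc⟩ := ih (fun i => a i - a i x₀ • a j) (b - b x₀ • a j) (by
        intro x hx
        have := h (x - a j x • x₀) (by
          intro i hi
          rcases Finset.mem_insert.1 hi with rfl | hi
          · simp [hjx₀]
          · have := hx i hi
            simp only [LinearMap.sub_apply, LinearMap.smul_apply, smul_eq_mul, map_sub,
              map_smul] at this ⊢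
            linarith)
        simp only [LinearMap.sub_apply, LinearMap.smul_apply, smul_eq_mul, map_sub,
          map_smul] at this ⊢
        linarith)
      refine ⟨Function.update c j (b x₀ - ∑ i ∈ s, c i * a i x₀), fun i hi => ?_, ?_⟩
      · by_cases hij : i = j
        · subst hij
          rw [Function.update_self, sub_nonneg]
          exact (Finset.sum_nonpos fun i hi =>
            mul_nonpos_of_nonneg_of_nonpos (hc i hi) (hx₀ i hi)).trans hbx₀.le
        · rw [Function.update_of_ne hij]
          exact hc i (Finset.mem_of_mem_insert_of_ne hi hij)
      · have hupd : ∑ i ∈ s, Function.update c j (b x₀ - ∑ i ∈ s, c i * a i x₀) i • a i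
            = ∑ i ∈ s, c i • a i := Finset.sum_congr rfl fun i hi => by
          rw [Function.update_of_ne (by rintro rfl; exact hj hi)]
        rw [Finset.sum_insert hj, Function.update_self, hupd]
        ext x
        have := LinearMap.congr_fun hbc x
        simp only [LinearMap.sub_apply, LinearMap.smul_apply, smul_eq_mul, LinearMap.sum_apply,
          LinearMap.add_apply, mul_sub, Finset.sum_sub_distrib, sub_mul, Finset.sum_mul] at this ⊢
        simp only [← mul_assoc] at this
        linarith

/-- Farkas' lemma for integer vectors: a vector that no rational functional separates from `S`
has a positive multiple which is a sum of elements of `S`. -/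
theorem exists_nsmul_mem_closure {κ : Type} [Fintype κ] {S : Set (κ → ℤ)} (hS : S.Finite)
    {x : κ → ℤ}
    (h : ∀ w : κ → ℚ, (∀ s ∈ S, ∑ i, w i * (s i : ℚ) ≤ 0) → ∑ i, w i * (x i : ℚ) ≤ 0) :
    ∃ N : ℕ, 0 < N ∧ N • x ∈ AddSubmonoid.closure S := by
  classical
  let L : (κ → ℤ) → (κ → ℚ) →ₗ[ℚ] ℚ := fun v =>
    { toFun := fun w => ∑ i, w i * (v i : ℚ)
      map_add' := fun a b => by simp [add_mul, Finset.sum_add_distrib]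
      map_smul' := fun a b => by simp [Finset.mul_sum, mul_assoc] }
  obtain ⟨c, hc, hx⟩ := mem_cone_of_forall_nonpos hS.toFinset L (L x) (fun w hw =>
    h w fun s hs => hw s (hS.mem_toFinset.2 hs))
  set T := hS.toFinset
  have hx' : ∀ k, (x k : ℚ) = ∑ s ∈ T, c s * (s k : ℚ) := by
    intro k
    have := LinearMap.congr_fun hx (Pi.single k 1)
    simpa [L, Pi.single_apply, LinearMap.sum_apply] using this
  let N : ℕ := ∏ s ∈ T, (c s).den
  have hN : 0 < N := Finset.prod_pos fun s _ => (c s).den_pos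
  have hm : ∀ s ∈ T, ∃ m : ℕ, (m : ℚ) = N * c s := by
    intro s hs
    -- `N` clears all denominators; `toNat` loses nothing because `c s` is nonnegative.
    refine ⟨(∏ t ∈ T.erase s, (c t).den) * (c s).num.toNat, ?_⟩
    have h1 : ((c s).num.toNat : ℚ) = (c s).num := by
      have : ((c s).num.toNat : ℤ) = (c s).num := Int.toNat_of_nonneg (Rat.num_nonneg.2 (hc s hs))
      exact_mod_cast this
    have h2 : (N : ℚ) = (∏ t ∈ T.erase s, (c t).den : ℕ) * (c s).den := by
      rw [← Nat.cast_mul, Finset.prod_erase_mul _ _ hs]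
    rw [Nat.cast_mul, h1, h2, mul_assoc, Rat.den_mul_eq_num]
  choose! m hm using hm
  refine ⟨N, hN, ?_⟩
  have : N • x = ∑ s ∈ T, m s • s := by
    funext k
    have : ((N • x) k : ℚ) = ((∑ s ∈ T, m s • s : κ → ℤ) k : ℚ) := by
      simp only [Pi.smul_apply, Finset.sum_apply, nsmul_eq_mul, Int.cast_mul, Int.cast_natCast,
        Int.cast_sum]
      rw [hx', Finset.mul_sum]
      exact Finset.sum_congr rfl fun s hs => by
        simp [← mul_assoc, hm s hs]
    exact_mod_cast this
  rw [this]
  exact AddSubmonoid.sum_mem _ fun s hs => AddSubmonoid.nsmul_mem _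
    (AddSubmonoid.subset_closure (hS.mem_toFinset.1 hs)) _

/-! ### Imsets as functionals on set functions -/

/-- The pairing of a function on subsets with an integer vector. -/
def pairing (w : Finset (Fin n) → ℝ) : (Finset (Fin n) → ℤ) →+ ℝ where
  toFun u := ∑ I, w I * (u I : ℝ)
  map_zero' := by simp
  map_add' u v := by simp [mul_add, Finset.sum_add_distrib]

theorem pairing_apply (w : Finset (Fin n) → ℝ) (u : Finset (Fin n) → ℤ) :
    pairing w u = ∑ I, w I * (u I : ℝ) := rfl

theorem pairing_imset (w : Finset (Fin n) → ℝ) (t : Triple n) :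
    pairing w (imset t) = w (t.1 ∪ t.2.1 ∪ t.2.2) + w t.2.2 - w (t.1 ∪ t.2.2)
      - w (t.2.1 ∪ t.2.2) := by
  simp [pairing_apply, imset, mul_add, mul_sub, Finset.sum_add_distrib, Finset.sum_sub_distrib,
    Pi.single_apply]

theorem pairing_sum_left {ι : Type*} (s : Finset ι) (f : ι → Finset (Fin n) → ℝ)
    (u : Finset (Fin n) → ℤ) : pairing (∑ i ∈ s, f i) u = ∑ i ∈ s, pairing (f i) u := by
  simp only [pairing_apply, Finset.sum_apply, Finset.sum_mul]
  exact Finset.sum_comm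

theorem pairing_sub_left (v w : Finset (Fin n) → ℝ) (u : Finset (Fin n) → ℤ) :
    pairing (v - w) u = pairing v u - pairing w u := by
  simp [pairing_apply, sub_mul, Finset.sum_sub_distrib]

theorem pairing_smul_left (c : ℝ) (w : Finset (Fin n) → ℝ) (u : Finset (Fin n) → ℤ) :
    pairing (c • w) u = c * pairing w u := by
  simp [pairing_apply, Finset.mul_sum, mul_assoc]

theorem mem_functionModel_iff {w : Finset (Fin n) → ℝ} {t : Triple n} :
    t ∈ functionModel w ↔ IsDisjointTriple t ∧ pairing w (imset t) = 0 := by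
  rw [pairing_imset]
  refine and_congr_right fun _ => ⟨fun h => by linarith, fun h => by linarith⟩

theorem finite_elementaryImsets : (elementaryImsets n).Finite := by
  refine (Set.finite_range fun p : Fin n × Fin n × Finset (Fin n) =>
    imset ({p.1}, {p.2.1}, p.2.2)).subset ?_
  rintro _ ⟨i, j, K, -, -, -, rfl⟩
  exact ⟨(i, j, K), rfl⟩

theorem imset_swap (A B C : Finset (Fin n)) : imset (A, B, C) = imset (B, A, C) := by
  simp only [imset, Finset.union_comm A B]
  abel

/-- The chain rule for conditional independence: on the right, the terms at `{a} ∪ B ∪ C` and `{a} ∪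
C` cancel. -/
theorem imset_insert (a : Fin n) (A B C : Finset (Fin n)) :
    imset (insert a A, B, C) = imset ({a}, B, C) + imset (A, B, insert a C) := by
  have e1 : A ∪ B ∪ insert a C = insert a A ∪ B ∪ C := by grind
  have e2 : A ∪ insert a C = insert a A ∪ C := by grind
  have e3 : B ∪ insert a C = {a} ∪ B ∪ C := by grind
  have e4 : insert a C = {a} ∪ C := by grind
  simp only [imset, e1, e2, e3]
  rw [e4]
  abel

theorem imset_empty (B C : Finset (Fin n)) : imset (∅, B, C) = 0 := by
  simp [imset, add_comm]

theorem isDisjointTriple_elementary {i j : Fin n} {K : Finset (Fin n)} (hij : i ≠ j) (hi : i ∉ K)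
    (hj : j ∉ K) : IsDisjointTriple (({i}, {j}, K) : Triple n) := by
  simp [IsDisjointTriple, hij, hi, hj]

/-- Semi-elementary imsets are sums of elementary ones. -/
theorem imset_mem_closure {t : Triple n} (ht : IsDisjointTriple t) :
    imset t ∈ AddSubmonoid.closure (elementaryImsets n) := by
  have single : ∀ (a : Fin n) (B C : Finset (Fin n)), a ∉ B → a ∉ C → Disjoint B C →
      imset ({a}, B, C) ∈ AddSubmonoid.closure (elementaryImsets n) := by
    intro a B
    induction B using Finset.induction_on with
    | empty =>
      intro C _ _ _
      rw [imset_swap, imset_empty]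
      exact zero_mem _
    | insert b B hb ih =>
      intro C h1 h2 h3
      rw [imset_swap, imset_insert, imset_swap, imset_swap B]
      exact add_mem (AddSubmonoid.subset_closure ⟨a, b, C, by grind, h2, by grind, rfl⟩)
        (ih _ (by grind) (by grind) (by grind [Finset.disjoint_left]))
  obtain ⟨A, B, C⟩ := t
  obtain ⟨h1, h2, h3⟩ := ht
  simp only at h1 h2 h3
  induction A using Finset.induction_on generalizing C with
  | empty =>
    rw [imset_empty]
    exact zero_mem _
  | insert a A ha ih =>
    rw [imset_insert]
    exact add_mem (single a B C (by grind [Finset.disjoint_left]) (by grind [Finset.disjoint_left])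
      h3) (ih _ (by grind [Finset.disjoint_left]) (by grind [Finset.disjoint_left])
        (by grind [Finset.disjoint_left]))

theorem IsSubmodular.pairing_imset_nonpos {w : Finset (Fin n) → ℝ} (hw : IsSubmodular w)
    {t : Triple n} (ht : IsDisjointTriple t) : pairing w (imset t) ≤ 0 := by
  have h := hw (t.1 ∪ t.2.2) (t.2.1 ∪ t.2.2)
  obtain ⟨h1, h2, h3⟩ := ht
  have e1 : (t.1 ∪ t.2.2) ∩ (t.2.1 ∪ t.2.2) = t.2.2 := by grind [Finset.disjoint_left]
  have e2 : (t.1 ∪ t.2.2) ∪ (t.2.1 ∪ t.2.2) = t.1 ∪ t.2.1 ∪ t.2.2 := by grind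
  rw [e1, e2] at h
  rw [pairing_imset]
  linarith

theorem IsSubmodular.pairing_elementary_nonpos {w : Finset (Fin n) → ℝ} (hw : IsSubmodular w)
    {e : Finset (Fin n) → ℤ} (he : e ∈ elementaryImsets n) : pairing w e ≤ 0 := by
  obtain ⟨i, j, K, hij, hi, hj, rfl⟩ := he
  exact hw.pairing_imset_nonpos (isDisjointTriple_elementary hij hi hj)

theorem pairing_closure_nonpos {w : Finset (Fin n) → ℝ}
    (h : ∀ e ∈ elementaryImsets n, pairing w e ≤ 0) {u : Finset (Fin n) → ℤ}
    (hu : u ∈ AddSubmonoid.closure (elementaryImsets n)) : pairing w u ≤ 0 := by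
  induction hu using AddSubmonoid.closure_induction with
  | mem x hx => exact h x hx
  | zero => simp
  | add x y _ _ hx hy => rw [map_add]; linarith

/-- The inequality for `I`, `J` is the pairing with the imset of `(I \ J, J \ I, I ∩ J)`, a sum of
elementary imsets. -/
theorem isSubmodular_of_elementary {w : Finset (Fin n) → ℝ}
    (h : ∀ e ∈ elementaryImsets n, pairing w e ≤ 0) : IsSubmodular w := by
  intro I J
  have ht : IsDisjointTriple ((I \ J, J \ I, I ∩ J) : Triple n) := by
    refine ⟨?_, ?_, ?_⟩ <;> grind [Finset.disjoint_left]
  have := pairing_closure_nonpos h (imset_mem_closure ht)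
  rw [pairing_imset] at this
  have e1 : I \ J ∪ J \ I ∪ I ∩ J = I ∪ J := by grind
  have e2 : I \ J ∪ I ∩ J = I := by grind
  have e3 : J \ I ∪ I ∩ J = J := by grind
  simp only [e1, e2, e3] at this
  linarith

/-! ### Domination -/

/-- `v` lies in the smallest face of the submodular cone that contains `w`. -/
def Dominates (w v : Finset (Fin n) → ℝ) : Prop :=
  ∃ c : ℝ, 0 < c ∧ IsSubmodular (w - c • v)

theorem IsSubmodular.add {v w : Finset (Fin n) → ℝ} (hv : IsSubmodular v) (hw : IsSubmodular w) :
    IsSubmodular (v + w) := by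
  intro I J
  have := hv I J
  have := hw I J
  simp only [Pi.add_apply]
  linarith

theorem IsSubmodular.smul {w : Finset (Fin n) → ℝ} (hw : IsSubmodular w) {c : ℝ} (hc : 0 ≤ c) :
    IsSubmodular (c • w) := by
  intro I J
  have := mul_le_mul_of_nonneg_left (hw I J) hc
  simp only [Pi.smul_apply, smul_eq_mul]
  linarith

theorem isSubmodular_zero : IsSubmodular (0 : Finset (Fin n) → ℝ) := by
  intro I J; simp

theorem isSubmodular_sum {ι : Type*} {s : Finset ι} {f : ι → Finset (Fin n) → ℝ}
    (h : ∀ i ∈ s, IsSubmodular (f i)) : IsSubmodular (∑ i ∈ s, f i) :=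
  Finset.sum_induction f IsSubmodular (fun _ _ => IsSubmodular.add) isSubmodular_zero h

theorem Dominates.refl (w : Finset (Fin n) → ℝ) : Dominates w w :=
  ⟨1, one_pos, by simpa using isSubmodular_zero⟩

theorem Dominates.trans {u v w : Finset (Fin n) → ℝ} (h : Dominates u v) (h' : Dominates v w) :
    Dominates u w := by
  obtain ⟨a, ha, ha'⟩ := h
  obtain ⟨b, hb, hb'⟩ := h'
  refine ⟨a * b, mul_pos ha hb, ?_⟩
  convert ha'.add (hb'.smul ha.le) using 1
  rw [smul_sub, smul_smul]
  abel

theorem Dominates.pairing_eq_zero {v w : Finset (Fin n) → ℝ} (h : Dominates w v)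
    (hv : IsSubmodular v) {t : Triple n} (ht : IsDisjointTriple t)
    (h0 : pairing w (imset t) = 0) : pairing v (imset t) = 0 := by
  obtain ⟨c, hc, hc'⟩ := h
  have h1 := hc'.pairing_imset_nonpos ht
  have h2 := hv.pairing_imset_nonpos ht
  rw [pairing_sub_left, pairing_smul_left, h0] at h1
  refine le_antisymm h2 ?_
  exact nonneg_of_mul_nonneg_right (by linarith : 0 ≤ c * pairing v (imset t)) hc

/-- The finitely many inequalities strict at `w` survive subtracting a small multiple of `v`; the
tight ones stay tight. -/
theorem dominates_of_elementary {v w : Finset (Fin n) → ℝ} (hw : IsSubmodular w)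
    (h : ∀ e ∈ elementaryImsets n, pairing w e = 0 → pairing v e = 0) : Dominates w v := by
  have key : ∀ᶠ c : ℝ in nhdsWithin 0 (Set.Ioi 0),
      ∀ e ∈ elementaryImsets n, pairing w e - c * pairing v e ≤ 0 := by
    rw [Filter.eventually_all_finite finite_elementaryImsets]
    intro e he
    rcases (hw.pairing_elementary_nonpos he).eq_or_lt with h0 | h0
    · simp [h0, h e he h0]
    · have hcont : Filter.Tendsto (fun c : ℝ => pairing w e - c * pairing v e) (nhds 0)
          (nhds (pairing w e - 0 * pairing v e)) := Continuous.tendsto (by fun_prop) 0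
      rw [zero_mul, sub_zero] at hcont
      exact ((hcont.eventually_lt_const h0).filter_mono nhdsWithin_le_nhds).mono fun _ hc => hc.le
  obtain ⟨c, hc, hc'⟩ := (key.and self_mem_nhdsWithin).exists
  refine ⟨c, hc', isSubmodular_of_elementary fun e he => ?_⟩
  rw [pairing_sub_left, pairing_smul_left]
  exact hc e he

theorem functionModel_subset {v w : Finset (Fin n) → ℝ} (h : Dominates w v)
    (hv : IsSubmodular v) : functionModel w ⊆ functionModel v := by
  intro t ht
  rw [mem_functionModel_iff] at ht ⊢
  exact ⟨ht.1, h.pairing_eq_zero hv ht.1 ht.2⟩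

theorem dominates_of_functionModel_subset {v w : Finset (Fin n) → ℝ} (hw : IsSubmodular w)
    (h : functionModel w ⊆ functionModel v) : Dominates w v := by
  refine dominates_of_elementary hw ?_
  rintro _ ⟨i, j, K, hij, hi, hj, rfl⟩ h0
  exact (mem_functionModel_iff.1 (h (mem_functionModel_iff.2
    ⟨isDisjointTriple_elementary hij hi hj, h0⟩))).2

/-! ### Rank tests and normal fans -/

theorem greedy_sub_smul (v w : Finset (Fin n) → ℝ) (c : ℝ) (δ : Equiv.Perm (Fin n)) :
    greedy (w - c • v) δ = greedy w δ - c • greedy v δ := by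
  funext i
  simp only [greedy, Pi.sub_apply, Pi.smul_apply, smul_eq_mul]
  ring

/-- Write `w = c • v + (w - c • v)`; greedy vertices split accordingly. For a chamber `ε` containing
`u`, both summands are optimal at `ε`, so if their total is optimal at `δ`, neither loses anything
there. -/
theorem Dominates.greedy_mem_maximizers {v w : Finset (Fin n) → ℝ} (h : Dominates w v)
    (hv0 : v ∅ = 0) (hv : IsSubmodular v) (hw0 : w ∅ = 0) (hw : IsSubmodular w)
    {δ : Equiv.Perm (Fin n)} {u : Fin n → ℝ}
    (hδ : greedy w δ ∈ maximizers (basePolytope w) u) :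
    greedy v δ ∈ maximizers (basePolytope v) u := by
  obtain ⟨c, hc, hc'⟩ := h
  obtain ⟨ε, hε⟩ := exists_mem_chamber u
  have hs0 : (w - c • v) ∅ = 0 := by simp [hv0, hw0]
  have a1 := hδ.2 _ (greedy_mem_basePolytope hw0 hw ε)
  have a2 := (RankTest.greedy_mem_maximizers hs0 hc' hε).2 _ (greedy_mem_basePolytope hs0 hc' δ)
  have hm := RankTest.greedy_mem_maximizers hv0 hv hε
  rw [greedy_sub_smul, greedy_sub_smul, dotProduct_sub, dotProduct_sub, dotProduct_smul,
    dotProduct_smul, smul_eq_mul, smul_eq_mul] at a2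
  have a3 : u ⬝ᵥ greedy v ε ≤ u ⬝ᵥ greedy v δ := le_of_mul_le_mul_left (by linarith) hc
  exact ⟨greedy_mem_basePolytope hv0 hv δ, fun y hy => (hm.2 y hy).trans a3⟩

theorem Dominates.greedyTest_le {v w : Finset (Fin n) → ℝ} (h : Dominates w v)
    (hv0 : v ∅ = 0) (hv : IsSubmodular v) (hw0 : w ∅ = 0) (hw : IsSubmodular w) :
    greedyTest w ≤ greedyTest v := by
  intro δ ε hδε
  have hδε : greedy w δ = greedy w ε := hδε
  obtain ⟨u, hu⟩ := exists_isDescentVector δ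
  have h1 := RankTest.greedy_mem_maximizers hw0 hw hu.mem_chamber
  rw [hδε] at h1
  have h2 := h.greedy_mem_maximizers hv0 hv hw0 hw h1
  rw [maximizers_eq_greedy hv0 hv hu] at h2
  exact h2.symm

/-- Each elementary inequality tight at `w` labels a wall that the test of `w`, hence that of `v`,
ignores. -/
theorem dominates_of_greedyTest_le {v w : Finset (Fin n) → ℝ} (hw : IsSubmodular w)
    (h : greedyTest w ≤ greedyTest v) : Dominates w v := by
  refine dominates_of_elementary hw ?_
  rintro _ ⟨i, j, K, hij, hi, hj, rfl⟩ h0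
  obtain ⟨δ, k, l, hkl, he⟩ := exists_wallLabel_eq hij hi hj
  have h1 : wallLabel δ k l ∈ functionModel w := by
    rw [he, mem_functionModel_iff]
    exact ⟨isDisjointTriple_elementary hij hi hj, h0⟩
  rw [wallLabel_mem_functionModel_iff w δ hkl] at h1
  have h2 := (wallLabel_mem_functionModel_iff v δ hkl).2 (h h1)
  rw [he, mem_functionModel_iff] at h2
  exact h2.2

/-- A face is spanned by the greedy vertices on it, so its normal cone can be read off there. -/
theorem mem_normalCone_maximizers_iff {w : Finset (Fin n) → ℝ} (h0 : w ∅ = 0)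
    (hw : IsSubmodular w) (c u : Fin n → ℝ) :
    u ∈ normalCone (basePolytope w) (maximizers (basePolytope w) c) ↔
      ∀ δ, greedy w δ ∈ maximizers (basePolytope w) c →
        greedy w δ ∈ maximizers (basePolytope w) u := by
  refine ⟨fun h δ hδ => h hδ, fun h y hy => ?_⟩
  have hconv := convex_basePolytope w
  have key : convexHull ℝ (Set.range (greedy w)) ⊆ {y | y ∈ basePolytope w ∧
      (y ∈ maximizers (basePolytope w) c → y ∈ maximizers (basePolytope w) u)} := by
    refine convexHull_min ?_ ?_
    · rintro _ ⟨δ, rfl⟩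
      exact ⟨greedy_mem_basePolytope h0 hw δ, h δ⟩
    · rintro x ⟨hx, hx'⟩ y ⟨hy, hy'⟩ a b ha hb hab
      refine ⟨hconv hx hy ha hb hab, fun hm => ⟨hm.1, fun z hz => ?_⟩⟩
      rcases ha.eq_or_lt with rfl | ha
      · rw [zero_add] at hab
        subst hab
        simp only [zero_smul, one_smul, zero_add] at hm ⊢
        exact (hy' hm).2 z hz
      rcases hb.eq_or_lt with rfl | hb
      · rw [add_zero] at hab
        subst hab
        simp only [zero_smul, one_smul, add_zero] at hm ⊢
        exact (hx' hm).2 z hz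
      -- An interior point of a segment maximizes `c` only if both ends do.
      have hcx := hm.2 x hx
      have hcy := hm.2 y hy
      simp only [dotProduct_add, dotProduct_smul, smul_eq_mul] at hcx hcy ⊢
      obtain rfl : b = 1 - a := by linarith
      have e1 : c ⬝ᵥ x ≤ c ⬝ᵥ y := le_of_mul_le_mul_left (by linarith) hb
      have e2 : c ⬝ᵥ y ≤ c ⬝ᵥ x := le_of_mul_le_mul_left (by linarith) ha
      have e3 : c ⬝ᵥ x = c ⬝ᵥ y := le_antisymm e1 e2
      have mx : ∀ z ∈ basePolytope w, c ⬝ᵥ z ≤ c ⬝ᵥ y := by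
        intro z hz
        have := hm.2 z hz
        simp only [dotProduct_add, dotProduct_smul, smul_eq_mul, e3] at this
        linarith
      have f1 := mul_le_mul_of_nonneg_left ((hx' ⟨hx, fun z hz => e3 ▸ mx z hz⟩).2 z hz) ha.le
      have f2 := mul_le_mul_of_nonneg_left ((hy' ⟨hy, mx⟩).2 z hz) hb.le
      linarith
  rw [← basePolytope_eq_convexHull h0 hw] at key
  exact (key hy.1).2 hy

theorem normalFan_basePolytope_subset {v w : Finset (Fin n) → ℝ} (h : Dominates w v)
    (h' : Dominates v w) (hv0 : v ∅ = 0) (hv : IsSubmodular v) (hw0 : w ∅ = 0)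
    (hw : IsSubmodular w) : normalFan (basePolytope w) ⊆ normalFan (basePolytope v) := by
  rintro _ ⟨_, ⟨-, c, rfl⟩, rfl⟩
  obtain ⟨δ, hδ⟩ := exists_mem_chamber c
  refine ⟨_, ⟨⟨_, greedy_mem_maximizers hv0 hv hδ⟩, c, rfl⟩, ?_⟩
  ext u
  rw [mem_normalCone_maximizers_iff hw0 hw, mem_normalCone_maximizers_iff hv0 hv]
  have key : ∀ c δ, greedy w δ ∈ maximizers (basePolytope w) c ↔
      greedy v δ ∈ maximizers (basePolytope v) c := fun c δ =>
    ⟨h.greedy_mem_maximizers hv0 hv hw0 hw, h'.greedy_mem_maximizers hw0 hw hv0 hv⟩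
  simp only [key]

/-! ### Faces of the submodular cone -/

/-- The smallest face of the submodular cone that contains `w`. -/
def minimalFace (w : Finset (Fin n) → ℝ) : Set (Finset (Fin n) → ℝ) :=
  {v | IsSubmodular v ∧ Dominates w v}

/-- A maximum attained on a cone is 0: compare `w` with `w + w` and with 0. -/
theorem dotProduct_nonpos_of_mem_maximizers {c w : Finset (Fin n) → ℝ}
    (hw : w ∈ maximizers (submodularCone n) c) :
    c ⬝ᵥ w = 0 ∧ ∀ v, IsSubmodular v → c ⬝ᵥ v ≤ 0 := by
  have hs : IsSubmodular w := hw.1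
  have h1 := hw.2 _ (hs.add hs : IsSubmodular (w + w))
  have h2 := hw.2 _ (isSubmodular_zero : IsSubmodular 0)
  rw [dotProduct_add] at h1
  rw [dotProduct_zero] at h2
  exact ⟨by linarith, fun v hv => (hw.2 v hv).trans (by linarith)⟩

theorem minimalFace_subset {w : Finset (Fin n) → ℝ} {F : Set (Finset (Fin n) → ℝ)}
    (hF : IsFace (submodularCone n) F) (hw : w ∈ F) : minimalFace w ⊆ F := by
  obtain ⟨-, c, rfl⟩ := hF
  obtain ⟨h1, h2⟩ := dotProduct_nonpos_of_mem_maximizers hw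
  rintro v ⟨hv, a, ha, hav⟩
  have h3 := h2 _ hav
  rw [dotProduct_sub, dotProduct_smul, smul_eq_mul, h1] at h3
  have h4 : 0 ≤ c ⬝ᵥ v := nonneg_of_mul_nonneg_right (by linarith : 0 ≤ a * (c ⬝ᵥ v)) ha
  exact ⟨hv, fun y hy => (h2 y hy).trans h4⟩

/-- The sum of the elementary imsets orthogonal to `w`. -/
noncomputable def tightImset (w : Finset (Fin n) → ℝ) : Finset (Fin n) → ℤ :=
  by classical exact ∑ e ∈ finite_elementaryImsets.toFinset with pairing w e = 0, e

theorem pairing_tightImset_eq_zero_iff {v w : Finset (Fin n) → ℝ} (hv : IsSubmodular v) :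
    pairing v (tightImset w) = 0 ↔
      ∀ e ∈ elementaryImsets n, pairing w e = 0 → pairing v e = 0 := by
  classical
  rw [tightImset, map_sum, Finset.sum_eq_zero_iff_of_nonpos fun e he =>
    hv.pairing_elementary_nonpos (by simpa using (Finset.mem_filter.1 he).1)]
  simp

theorem tightImset_mem_closure (w : Finset (Fin n) → ℝ) :
    tightImset w ∈ AddSubmonoid.closure (elementaryImsets n) := by
  classical
  exact sum_mem fun e he => AddSubmonoid.subset_closure (by simpa using (Finset.mem_filter.1 he).1)

/-- Pairing with `tightImset w` is nonpositive on the cone and vanishes exactly where all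
inequalities tight at `w` are tight. -/
theorem isFace_minimalFace {w : Finset (Fin n) → ℝ} (hw : IsSubmodular w) :
    IsFace (submodularCone n) (minimalFace w) := by
  refine ⟨⟨w, hw, .refl w⟩, fun I => (tightImset w I : ℝ), ?_⟩
  have hc : ∀ v, (fun I => (tightImset w I : ℝ)) ⬝ᵥ v = pairing v (tightImset w) := fun v => by
    rw [dotProduct_comm]; rfl
  have hnp : ∀ v, IsSubmodular v → pairing v (tightImset w) ≤ 0 := fun v hv =>
    pairing_closure_nonpos (fun _ => hv.pairing_elementary_nonpos) (tightImset_mem_closure w)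
  ext v
  constructor
  · rintro ⟨hv, hwv⟩
    refine ⟨hv, fun y hy => ?_⟩
    rw [hc, hc, (pairing_tightImset_eq_zero_iff hv).2]
    · exact hnp y hy
    · rintro _ ⟨i, j, K, hij, hi, hj, rfl⟩ h0
      exact hwv.pairing_eq_zero hv (isDisjointTriple_elementary hij hi hj) h0
  · intro hv
    have h1 := (dotProduct_nonpos_of_mem_maximizers hv).1
    rw [hc, pairing_tightImset_eq_zero_iff hv.1] at h1
    exact ⟨hv.1, dominates_of_elementary hw h1⟩

theorem IsSubmodular.sub_const {w : Finset (Fin n) → ℝ} (hw : IsSubmodular w) (c : ℝ) :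
    IsSubmodular (fun I => w I - c) := by
  intro I J
  have := hw I J
  linarith

/-- For each elementary imset, choose a point of `F` not tight there if one exists. The sum of these
points is tight only where all of `F` is, so it dominates every point of `F`. -/
theorem IsFace.exists_minimalFace_eq {F : Set (Finset (Fin n) → ℝ)}
    (hF : IsFace (submodularCone n) F) :
    ∃ w, IsSubmodular w ∧ w ∅ = 0 ∧ minimalFace w = F := by
  classical
  have hF' := hF
  obtain ⟨⟨w₀, hw₀⟩, c, rfl⟩ := hF
  obtain ⟨h1, h2⟩ := dotProduct_nonpos_of_mem_maximizers hw₀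
  have hmem : ∀ v, v ∈ maximizers (submodularCone n) c ↔ IsSubmodular v ∧ c ⬝ᵥ v = 0 :=
    fun v => ⟨fun hv => ⟨hv.1, (dotProduct_nonpos_of_mem_maximizers hv).1⟩,
      fun hv => ⟨hv.1, fun y hy => (h2 y hy).trans hv.2.ge⟩⟩
  have hv : ∀ e : Finset (Fin n) → ℤ, ∃ v ∈ maximizers (submodularCone n) c, pairing v e = 0 →
      ∀ v' ∈ maximizers (submodularCone n) c, pairing v' e = 0 := by
    intro e
    by_cases h : ∀ v' ∈ maximizers (submodularCone n) c, pairing v' e = 0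
    · exact ⟨w₀, hw₀, fun _ => h⟩
    · push Not at h
      obtain ⟨v, hv, hv'⟩ := h
      exact ⟨v, hv, fun h => absurd h hv'⟩
  choose v hv hv' using hv
  have hsub : ∀ e, IsSubmodular (v e) := fun e => (hv e).1
  set w := ∑ e ∈ finite_elementaryImsets.toFinset, v e with hw_def
  have hw : IsSubmodular w := isSubmodular_sum fun e _ => hsub e
  have hwF : w ∈ maximizers (submodularCone n) c := by
    rw [hmem]
    refine ⟨hw, ?_⟩
    rw [hw_def, dotProduct_sum]
    exact Finset.sum_eq_zero fun e _ => ((hmem _).1 (hv e)).2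
  have key : minimalFace w = maximizers (submodularCone n) c := by
    refine Set.Subset.antisymm (minimalFace_subset hF' hwF) fun x hx => ⟨hx.1, ?_⟩
    refine dominates_of_elementary hw fun e he h0 => hv' e ?_ x hx
    rw [hw_def, pairing_sum_left, Finset.sum_eq_zero_iff_of_nonpos fun e' _ =>
      (hsub e').pairing_elementary_nonpos he] at h0
    exact h0 e (by simpa using he)
  -- Constants are modular, so normalizing at `∅` does not affect domination.
  refine ⟨fun I => w I - w ∅, hw.sub_const _, sub_self _, ?_⟩
  rw [← key]
  ext x
  refine and_congr_right fun _ => exists_congr fun a => and_congr_right fun _ =>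
    ⟨fun h => ?_, fun h => ?_⟩
  · convert h.sub_const (-w ∅) using 1
    funext I
    simp only [Pi.sub_apply, Pi.smul_apply, smul_eq_mul]
    ring
  · convert h.sub_const (w ∅) using 1
    funext I
    simp only [Pi.sub_apply, Pi.smul_apply, smul_eq_mul]
    ring

/-! ### Structural models -/

theorem IsStructuralImset.pairing_nonpos {u : Finset (Fin n) → ℤ} (hu : IsStructuralImset u)
    {w : Finset (Fin n) → ℝ} (h : ∀ e ∈ elementaryImsets n, pairing w e ≤ 0) :
    pairing w u ≤ 0 := by
  obtain ⟨k, hk, hk'⟩ := hu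
  have := pairing_closure_nonpos h hk'
  rw [map_nsmul, nsmul_eq_mul] at this
  have hk : (0 : ℝ) < k := by exact_mod_cast hk
  exact nonpos_of_mul_nonpos_right this hk

theorem isStructuralImset_of_mem_closure {u : Finset (Fin n) → ℤ}
    (hu : u ∈ AddSubmonoid.closure (elementaryImsets n)) : IsStructuralImset u :=
  ⟨1, one_pos, by simpa using hu⟩

theorem IsStructuralImset.add {u v : Finset (Fin n) → ℤ} (hu : IsStructuralImset u)
    (hv : IsStructuralImset v) : IsStructuralImset (u + v) := by
  obtain ⟨a, ha, ha'⟩ := hu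
  obtain ⟨b, hb, hb'⟩ := hv
  refine ⟨a * b, mul_pos ha hb, ?_⟩
  rw [nsmul_add, mul_comm, mul_nsmul', mul_comm, mul_nsmul']
  exact add_mem (AddSubmonoid.nsmul_mem _ ha' b) (AddSubmonoid.nsmul_mem _ hb' a)

theorem IsStructuralImset.nsmul {u : Finset (Fin n) → ℤ} (hu : IsStructuralImset u) (m : ℕ) :
    IsStructuralImset (m • u) := by
  obtain ⟨a, ha, ha'⟩ := hu
  refine ⟨a, ha, ?_⟩
  rw [smul_comm]
  exact AddSubmonoid.nsmul_mem _ ha' m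

theorem IsStructuralImset.of_nsmul {u : Finset (Fin n) → ℤ} {m : ℕ} (hm : 0 < m)
    (hu : IsStructuralImset (m • u)) : IsStructuralImset u := by
  obtain ⟨a, ha, ha'⟩ := hu
  exact ⟨a * m, mul_pos ha hm, by rwa [mul_nsmul', smul_smul] at *⟩

/-- Only elementary statements need testing: a sum of elementary imsets pairs to 0 with `w` only if
each term does, and the witnesses `k` add up. -/
theorem functionModel_eq_of_pairing {w : Finset (Fin n) → ℝ} (hw : IsSubmodular w)
    {u : Finset (Fin n) → ℤ} (hu : IsStructuralImset u) (hwu : pairing w u = 0)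
    (h : ∀ e ∈ elementaryImsets n, pairing w e = 0 →
      ∃ k : ℕ, 0 < k ∧ IsStructuralImset (k • u - e)) :
    functionModel w = imsetModel u := by
  have hE := fun e (he : e ∈ elementaryImsets n) => hw.pairing_elementary_nonpos he
  have key : ∀ x ∈ AddSubmonoid.closure (elementaryImsets n), pairing w x = 0 →
      ∃ k : ℕ, 0 < k ∧ IsStructuralImset (k • u - x) := by
    intro x hx
    induction hx using AddSubmonoid.closure_induction with
    | mem x hx => exact h x hx
    | zero => exact fun _ => ⟨1, one_pos, by simpa using hu⟩
    | add x y hx hy ihx ihy =>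
      intro h0
      have h1 := pairing_closure_nonpos hE hx
      have h2 := pairing_closure_nonpos hE hy
      rw [map_add] at h0
      obtain ⟨a, ha, ha'⟩ := ihx (by linarith)
      obtain ⟨b, hb, hb'⟩ := ihy (by linarith)
      refine ⟨a + b, by omega, ?_⟩
      convert ha'.add hb' using 1
      rw [add_smul]
      abel
  ext t
  rw [mem_functionModel_iff]
  refine and_congr_right fun ht => ⟨key _ (imset_mem_closure ht), ?_⟩
  rintro ⟨k, -, hk⟩
  have h1 := hk.pairing_nonpos hE
  rw [map_sub, map_nsmul, hwu, smul_zero] at h1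
  exact le_antisymm (hw.pairing_imset_nonpos ht) (by linarith)

theorem isStructuralModel_functionModel {w : Finset (Fin n) → ℝ} (hw : IsSubmodular w) :
    IsStructuralModel (functionModel w) := by
  classical
  refine ⟨tightImset w, isStructuralImset_of_mem_closure (tightImset_mem_closure w),
    functionModel_eq_of_pairing hw (isStructuralImset_of_mem_closure (tightImset_mem_closure w))
      ((pairing_tightImset_eq_zero_iff hw).2 fun _ _ h => h) fun e he h0 => ⟨1, one_pos, ?_⟩⟩
  refine isStructuralImset_of_mem_closure ?_
  rw [one_smul, tightImset, ← Finset.add_sum_erase (a := e) _ _ (by simp [he, h0]),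
    add_sub_cancel_left]
  exact sum_mem fun e' he' => AddSubmonoid.subset_closure (by simp at he'; exact he'.2.1)

/-- A submodular function that separates an elementary imset from a structural model. -/
theorem exists_separating {u : Finset (Fin n) → ℤ} (hu : IsStructuralImset u)
    {e : Finset (Fin n) → ℤ} (he : ∀ k : ℕ, 0 < k → ¬ IsStructuralImset (k • u - e)) :
    ∃ w : Finset (Fin n) → ℝ, IsSubmodular w ∧ pairing w u = 0 ∧ pairing w e ≠ 0 := by
  by_contra! hc
  obtain ⟨N, hN, hN'⟩ := exists_nsmul_mem_closure (S := elementaryImsets n ∪ {-u}) (x := -e)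
    (finite_elementaryImsets.union (Set.finite_singleton _)) (by
      intro w hw
      have hcast : ∀ v : Finset (Fin n) → ℤ, pairing (fun I => (w I : ℝ)) v
          = ((∑ I, w I * (v I : ℚ) : ℚ) : ℝ) := fun v => by
        rw [pairing_apply]; push_cast; rfl
      have hE : ∀ e ∈ elementaryImsets n, pairing (fun I => (w I : ℝ)) e ≤ 0 := fun e he => by
        rw [hcast]
        exact_mod_cast hw e (Or.inl he)
      -- Having `-u` among the generators forces the pairing with `u` to vanish.
      have h1 : pairing (fun I => (w I : ℝ)) (-u) ≤ 0 := by
        rw [hcast]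
        exact_mod_cast hw (-u) (Or.inr rfl)
      rw [map_neg] at h1
      have h2 := hc _ (isSubmodular_of_elementary hE)
        (le_antisymm (hu.pairing_nonpos hE) (by linarith))
      have h3 : pairing (fun I => (w I : ℝ)) (-e) ≤ 0 := by rw [map_neg, h2, neg_zero]
      rw [hcast] at h3
      exact_mod_cast h3)
  rw [AddSubmonoid.closure_union, AddSubmonoid.mem_sup] at hN'
  obtain ⟨a, ha, b, hb, hab⟩ := hN'
  obtain ⟨p, rfl⟩ := AddSubmonoid.mem_closure_singleton.1 hb
  -- From `N • (-e) = a - p • u`, the choice `k = p + 1` leaves `a` plus `N * (p + 1) - p` copies of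
  -- `u`; this count is positive since `N ≥ 1`.
  refine he (p + 1) p.succ_pos (.of_nsmul hN ?_)
  obtain ⟨M, rfl⟩ : ∃ M, N = M + 1 := ⟨N - 1, by omega⟩
  have e1 : (M + 1) • ((p + 1) • u - e) = a + (M * (p + 1) + 1) • u := by
    have : (M + 1) • (-e) = a - p • u := by rw [← hab, smul_neg]; abel
    rw [smul_sub, sub_eq_add_neg, ← smul_neg, this, smul_smul]
    have : (M + 1) * (p + 1) = M * (p + 1) + 1 + p := by ring
    rw [this, add_smul _ p]
    abel
  rw [e1]
  exact (isStructuralImset_of_mem_closure ha).add (hu.nsmul _)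

theorem pairing_const (c : ℝ) {u : Finset (Fin n) → ℤ} (hu : IsStructuralImset u) :
    pairing (fun _ => c) u = 0 := by
  have key : ∀ c, pairing (fun _ => c) u ≤ 0 := fun c =>
    hu.pairing_nonpos fun e he => IsSubmodular.pairing_elementary_nonpos (fun I J => le_rfl) he
  refine le_antisymm (key c) ?_
  have h := key (-c)
  simp only [pairing_apply, neg_mul, Finset.sum_neg_distrib] at h ⊢
  linarith

/-- The sum of the separating functions of all elementary imsets still vanishes on `u`, and vanishes
on an elementary imset only if its statement is in the model. -/
theorem IsStructuralModel.exists_functionModel_eq {M : Set (Triple n)}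
    (hM : IsStructuralModel M) : ∃ w, IsSubmodular w ∧ w ∅ = 0 ∧ functionModel w = M := by
  classical
  obtain ⟨u, hu, rfl⟩ := hM
  have hex : ∀ e : Finset (Fin n) → ℤ, ∃ w : Finset (Fin n) → ℝ, IsSubmodular w ∧
      pairing w u = 0 ∧ (pairing w e = 0 → ∃ k : ℕ, 0 < k ∧ IsStructuralImset (k • u - e)) := by
    intro e
    by_cases h : ∃ k : ℕ, 0 < k ∧ IsStructuralImset (k • u - e)
    · exact ⟨0, isSubmodular_zero, by simp [pairing_apply], fun _ => h⟩
    · push Not at h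
      obtain ⟨w, h1, h2, h3⟩ := exists_separating hu h
      exact ⟨w, h1, h2, fun h => absurd h h3⟩
  choose f hf hfu hfe using hex
  set w := ∑ e ∈ finite_elementaryImsets.toFinset, f e with hw_def
  have hw : IsSubmodular w := isSubmodular_sum fun e _ => hf e
  have hshift : ∀ x, pairing (fun I => w I - w ∅) x = pairing w x - pairing (fun _ => w ∅) x :=
    fun x => pairing_sub_left w (fun _ => w ∅) x
  refine ⟨fun I => w I - w ∅, hw.sub_const _, sub_self _,
    functionModel_eq_of_pairing (hw.sub_const _) hu ?_ fun e he h0 => hfe e ?_⟩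
  · rw [hshift, pairing_const _ hu, hw_def, pairing_sum_left]
    simp [hfu]
  · rw [hshift, pairing_const _
      (isStructuralImset_of_mem_closure (AddSubmonoid.subset_closure he)), sub_zero, hw_def,
      pairing_sum_left, Finset.sum_eq_zero_iff_of_nonpos fun e' _ =>
      (hf e').pairing_elementary_nonpos he] at h0
    exact h0 e (by simpa using he)

/-! ### The four surjections and their common kernel -/

/-- Surjections with equal kernels identify their codomains. -/
theorem exists_equiv_of_ker_eq {W A B : Type*} {f : W → A} {g : W → B}
    (hf : Function.Surjective f) (hg : Function.Surjective g)
    (h : ∀ v w, f v = f w ↔ g v = g w) : ∃ e : A ≃ B, ∀ w, e (f w) = g w := by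
  have hker : Setoid.ker f = Setoid.ker g := Setoid.ext fun v w => h v w
  refine ⟨(Setoid.quotientKerEquivOfSurjective f hf).symm.trans
    ((Quotient.congrRight fun v w => h v w).trans (Setoid.quotientKerEquivOfSurjective g hg)),
    fun w => ?_⟩
  have : (Setoid.quotientKerEquivOfSurjective f hf).symm (f w) = Quotient.mk _ w := by
    rw [Equiv.symm_apply_eq]; rfl
  rw [Equiv.trans_apply, this]
  rfl

/-- Submodular functions that vanish at the empty set. -/
abbrev NormalizedSubmodular (n : ℕ) : Type :=
  {w : Finset (Fin n) → ℝ // IsSubmodular w ∧ w ∅ = 0}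

namespace NormalizedSubmodular

def rankTest (w : NormalizedSubmodular n) : SubmodularRankTest n :=
  ⟨greedyTest w.1, w.1, w.2.2, w.2.1, isTestOf_greedyTest w.2.2 w.2.1⟩

def summand (w : NormalizedSubmodular n) : Summand n :=
  ⟨basePolytope w.1, isSummand_basePolytope w.2.2 w.2.1⟩

def model (w : NormalizedSubmodular n) : StructuralModel n :=
  ⟨functionModel w.1, isStructuralModel_functionModel w.2.1⟩

def face (w : NormalizedSubmodular n) : SubmodularFace n :=
  ⟨minimalFace w.1, isFace_minimalFace w.2.1⟩

theorem rankTest_surjective : Function.Surjective (rankTest (n := n)) := by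
  rintro ⟨τ, w, h0, hw, hτ⟩
  exact ⟨⟨w, hw, h0⟩, Subtype.ext (hτ.eq_greedyTest h0 hw).symm⟩

theorem summand_surjective : Function.Surjective (summand (n := n)) := by
  rintro ⟨Q, hQ⟩
  obtain ⟨w, hw, h0, rfl⟩ := hQ.exists_basePolytope_eq
  exact ⟨⟨w, hw, h0⟩, rfl⟩

theorem model_surjective : Function.Surjective (model (n := n)) := by
  rintro ⟨M, hM⟩
  obtain ⟨w, hw, h0, rfl⟩ := hM.exists_functionModel_eq
  exact ⟨⟨w, hw, h0⟩, rfl⟩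

theorem face_surjective : Function.Surjective (face (n := n)) := by
  rintro ⟨F, hF⟩
  obtain ⟨w, hw, h0, rfl⟩ := hF.exists_minimalFace_eq
  exact ⟨⟨w, hw, h0⟩, rfl⟩

theorem rankTest_eq_iff (v w : NormalizedSubmodular n) :
    v.rankTest = w.rankTest ↔ Dominates v.1 w.1 ∧ Dominates w.1 v.1 := by
  rw [Subtype.ext_iff]
  exact ⟨fun h => ⟨dominates_of_greedyTest_le v.2.1 h.le, dominates_of_greedyTest_le w.2.1 h.ge⟩,
    fun h => le_antisymm (h.1.greedyTest_le w.2.2 w.2.1 v.2.2 v.2.1)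
      (h.2.greedyTest_le v.2.2 v.2.1 w.2.2 w.2.1)⟩

/-- Equal fans induce the same rank test, which already determines mutual domination. -/
theorem toClass_summand_eq_iff (v w : NormalizedSubmodular n) :
    v.summand.toClass = w.summand.toClass ↔ Dominates v.1 w.1 ∧ Dominates w.1 v.1 := by
  have hq : v.summand.toClass = w.summand.toClass ↔
      normalFan (basePolytope v.1) = normalFan (basePolytope w.1) := Quotient.eq
  rw [hq]
  constructor
  · intro h
    rw [← rankTest_eq_iff]
    refine Subtype.ext (IsInducedBy.eq (isInducedBy_greedyTest v.2.2 v.2.1) ?_)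
    rw [h]
    exact isInducedBy_greedyTest w.2.2 w.2.1
  · exact fun h => Set.Subset.antisymm
      (normalFan_basePolytope_subset h.1 h.2 w.2.2 w.2.1 v.2.2 v.2.1)
      (normalFan_basePolytope_subset h.2 h.1 v.2.2 v.2.1 w.2.2 w.2.1)

theorem model_eq_iff (v w : NormalizedSubmodular n) :
    v.model = w.model ↔ Dominates v.1 w.1 ∧ Dominates w.1 v.1 := by
  rw [Subtype.ext_iff]
  exact ⟨fun h => ⟨dominates_of_functionModel_subset v.2.1 h.le,
      dominates_of_functionModel_subset w.2.1 h.ge⟩,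
    fun h => Set.Subset.antisymm (functionModel_subset h.1 w.2.1)
      (functionModel_subset h.2 v.2.1)⟩

theorem face_eq_iff (v w : NormalizedSubmodular n) :
    v.face = w.face ↔ Dominates v.1 w.1 ∧ Dominates w.1 v.1 := by
  rw [Subtype.ext_iff]
  constructor
  · intro h
    have h : minimalFace v.1 = minimalFace w.1 := h
    have hv : v.1 ∈ minimalFace v.1 := ⟨v.2.1, .refl _⟩
    have hw : w.1 ∈ minimalFace w.1 := ⟨w.2.1, .refl _⟩
    rw [h] at hv
    rw [← h] at hw
    exact ⟨hw.2, hv.2⟩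
  · exact fun h => Set.ext fun x => and_congr_right fun _ => ⟨h.2.trans, h.1.trans⟩

end NormalizedSubmodular

end RankTest

theorem theorem4p3 (n : ℕ) (hn : 0 < n) :
    ∃ (toSummand : SubmodularRankTest n ≃ SummandClass n)
      (toModel : SubmodularRankTest n ≃ StructuralModel n)
      (toFace : SubmodularRankTest n ≃ SubmodularFace n),
      (∀ (τ : SubmodularRankTest n) (Q : Summand n),
        toSummand τ = Q.toClass ↔ IsInducedBy τ.1 (normalFan Q.1)) ∧
      (∀ (τ : SubmodularRankTest n) (δ : Equiv.Perm (Fin n)) (k l : Fin n),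
        (k : ℕ) + 1 = (l : ℕ) →
          (wallLabel δ k l ∈ (toModel τ).1 ↔ τ.1 δ (δ * Equiv.swap k l))) ∧
      (∀ w : Finset (Fin n) → ℝ, IsSubmodular w → w ∅ = 0 →
        ∃ τ : SubmodularRankTest n, IsTestOf τ.1 w ∧
          (∃ hQ : IsSummand n (basePolytope w),
            toSummand τ = Summand.toClass ⟨basePolytope w, hQ⟩) ∧
          (toModel τ).1 = functionModel w ∧
          IsLeast {F : SubmodularFace n | w ∈ F.1} (toFace τ)) := by
  obtain ⟨toSummand, hS⟩ := exists_equiv_of_ker_eq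
    (NormalizedSubmodular.rankTest_surjective (n := n))
    (Quotient.mk_surjective.comp NormalizedSubmodular.summand_surjective)
    fun v w => (v.rankTest_eq_iff w).trans (v.toClass_summand_eq_iff w).symm
  obtain ⟨toModel, hM⟩ := exists_equiv_of_ker_eq
    (NormalizedSubmodular.rankTest_surjective (n := n)) NormalizedSubmodular.model_surjective
    fun v w => (v.rankTest_eq_iff w).trans (v.model_eq_iff w).symm
  obtain ⟨toFace, hF⟩ := exists_equiv_of_ker_eq
    (NormalizedSubmodular.rankTest_surjective (n := n)) NormalizedSubmodular.face_surjective
    fun v w => (v.rankTest_eq_iff w).trans (v.face_eq_iff w).symm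
  refine ⟨toSummand, toModel, toFace, fun τ Q => ?_, fun τ δ k l hkl => ?_, fun w hw h0 => ?_⟩
  · obtain ⟨v, rfl⟩ := NormalizedSubmodular.summand_surjective Q
    have hv : toSummand v.rankTest = v.summand.toClass := hS v
    have hind : IsInducedBy v.rankTest.1 (normalFan v.summand.1) :=
      isInducedBy_greedyTest v.2.2 v.2.1
    rw [← hv, toSummand.apply_eq_iff_eq]
    exact ⟨fun h => h ▸ hind, fun h => Subtype.ext (h.eq hind)⟩
  · obtain ⟨v, rfl⟩ := NormalizedSubmodular.rankTest_surjective τ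
    rw [hM]
    exact wallLabel_mem_functionModel_iff v.1 δ hkl
  · let v : NormalizedSubmodular n := ⟨w, hw, h0⟩
    refine ⟨v.rankTest, isTestOf_greedyTest h0 hw, ⟨v.summand.2, hS v⟩, by rw [hM]; rfl, ?_⟩
    rw [hF]
    exact ⟨⟨hw, .refl w⟩, fun G hG => minimalFace_subset G.2 hG⟩
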